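/- **Setting.** There are $K$ arms; arm $a$ has Bernoulli rewards of mean $\mu_a\in[0,1]$. Put $\mu^*=\max_a\mu_a$ and $\Delta_a=\mu^*-\mu_a$. For $p,q\in[0,1]$ let $d(p,q)=p\log\frac pq+(1-p)\log\frac{1-p}{1-q}\in[0,\infty]$ be the Bernoulli relative entropy, with the usual conventions (in particular $d(p,0)=\infty$ for $p\ne 0$ and $d(p,1)=\infty$ for $p\neq1$). A randomised policy that is fed rewards $r^T=(r_1,\dots,r_T)$ plays the action sequence $a^T$ with probability $\pi(a^T\mid r^T)$. It is *$\epsilon$-global DP* if $\pi(a^T\mid r^T)\le e^{\epsilon}\,\pi(a^T\mid r'^T)$ for every $a^T\in[K]^T$ and all $r^T,r'^T\in[0,1]^T$ that differ in exactly one round. In the environment, the history $(a^T,r^T)$ has probability $\pi(a^T\mid r^T)\prod_{t}\nu_{a_t}(r_t)$, where $\nu_a$ is the Bernoulli law of mean $\mu_a$, and the regret is $\mathrm{Reg}_T=T\mu^*-\mathbb E\big[\sum_{t=1}^T R_t\big]$. **AdaP-KLUCB** with parameters $\epsilon>0$ and $\alpha>0$. Play every arm once, in order. Then proceed in episodes $\ell=1,2,\dots$.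 Let $t_\ell$ be the first round of episode $\ell$ and $N_a=N_a(t_\ell-1)$ the number of earlier plays of arm $a$. The episode plays one arm $A_\ell$ maximising the index $I_a$ below (ties are broken by any fixed measurable rule) until the number of plays of that arm has doubled. The index is $$I_a=\max\Big\{q\in[0,1]:\ d(\breve\mu_a,q)\le \frac{\alpha\log t_\ell}{\frac12N_a}\Big\},\qquad \breve\mu_a=\min\Big\{1,\max\Big\{0,\ \tilde\mu_a+\frac{\alpha\log t_\ell}{\epsilon\,\frac12N_a}\Big\}\Big\},$$ where $\tilde\mu_a=\hat\mu_a+\mathrm{Lap}\big(\frac{2}{\epsilon N_a}\big)$, $\hat\mu_a$ is the mean of the rewards of arm $a$ collected in the last episode in which it was played (the initial play, if there is none), and the Laplace noise is drawn once for each such episode, independently of everything else, and reused until the arm is played again. **Theorem.** (i) For all $\epsilon>0$, $\alpha>0$ and every horizon $T$, AdaP-KLUCB is $\epsilon$-global DP. (ii) There are an absolute constant $C_2>0$ and, for every $\alpha>3$, a constant $C_1(\alpha)>0$ depending on $\alpha$ only, such that for all $K$, all $\epsilon>0$, all means $\mu\in[0,1]^K$ and all horizons $T$, $$\mathrm{Reg}_T\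 \le\ \sum_{a:\Delta_a>0}\left(\frac{C_1(\alpha)\,\Delta_a}{\min\{d(\mu_a,\mu^*),\,C_2\,\epsilon\,\Delta_a\}}\log T+\frac{3\alpha}{\alpha-3}\right)$$ (with $\log 0$ read as $0$ when $T=0$). (iii) Consequently the regret has, up to a constant, the form $\sum_{a:\Delta_a>0}\Delta_a/\min\{d(\mu_a,\mu^*),6\epsilon\Delta_a\}$ of the problem-dependent lower bound for Bernoulli bandits: for every $\alpha>3$ there is a constant $C_3(\alpha)>0$ depending on $\alpha$ only such that, for all $K$, $\epsilon>0$ and $\mu\in[0,1]^K$, $$\limsup_{T\to\infty}\frac{\mathrm{Reg}_T}{\log T}\ \le\ C_3(\alpha)\sum_{a:\Delta_a>0}\frac{\Delta_a}{\min\{d(\mu_a,\mu^*),\,6\,\epsilon\,\Delta_a\}} .$$ -/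

import Mathlib

noncomputable section

open MeasureTheory

namespace PrivateBandit

/-! ### Bernoulli relative entropy and Laplace noise -/

/-- Relative entropy `d(p, q)` between the Bernoulli distributions of means `p, q ∈ [0,1]`, with
values in the extended reals: `d(p, 0) = ∞` for `p ≠ 0` and `d(p, 1) = ∞` for `p ≠ 1`. In the
remaining cases the conventions `log 0 = 0` and `x / 0 = 0` give the usual limits. -/
def klBer (p q : ℝ) : EReal :=
  if (q = 0 ∧ p ≠ 0) ∨ (q = 1 ∧ p ≠ 1) then ⊤
  else ((p * Real.log (p / q) + (1 - p) * Real.log ((1 - p) / (1 - q)) : ℝ) : EReal)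

/-- The centred Laplace distribution of scale `b` (variance `2 b ^ 2`). -/
def laplace (b : ℝ) : Measure ℝ :=
  volume.withDensity fun x => ENNReal.ofReal (Real.exp (-|x| / b) / (2 * b))

theorem isProbabilityMeasure_laplace {b : ℝ} (hb : 0 < b) : IsProbabilityMeasure (laplace b) := by
  have hI : ∫ x : ℝ, Real.exp (-|x| / b) / (2 * b) = 1 := by
    rw [integral_comp_abs (f := fun x : ℝ => Real.exp (-x / b) / (2 * b)), integral_div]
    have h1 : (fun x : ℝ => Real.exp (-x / b)) = fun x => Real.exp (-b⁻¹ * x) := by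
      funext x
      congr 1
      ring
    rw [h1, integral_exp_mul_Ioi (neg_lt_zero.mpr (inv_pos.mpr hb))]
    simp only [mul_zero, Real.exp_zero]
    field_simp
  refine ⟨?_⟩
  rw [laplace, withDensity_apply _ MeasurableSet.univ, Measure.restrict_univ,
    ← ofReal_integral_eq_lintegral_ofReal (integrable_of_integral_eq_one hI)
      (Filter.Eventually.of_forall fun x => by positivity), hI, ENNReal.ofReal_one]

/-! ### Bandit policies, global differential privacy, regret

Rounds are numbered `0, …, T - 1` and arms are `Fin K`. -/

/-- The action law of a policy over `T` rounds: `π a r` is the probability that the policy plays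
the action sequence `a` when it is fed the reward sequence `r`, i.e. `π(a^T ∣ r^T)`. -/
abbrev ActionLaw (K T : ℕ) := (Fin T → Fin K) → (Fin T → ℝ) → ℝ

/-- Two reward sequences that differ in exactly one round. -/
def Neighbouring {T : ℕ} (r r' : Fin T → ℝ) : Prop :=
  ∃ j, r j ≠ r' j ∧ ∀ t, t ≠ j → r t = r' t

/-- `ε`-global differential privacy, for rewards in `[0, 1]`. -/
def IsGlobalDP {K T : ℕ} (ε : ℝ) (π : ActionLaw K T) : Prop :=
  ∀ (a : Fin T → Fin K) (r r' : Fin T → ℝ),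
    (∀ t, r t ∈ Set.Icc (0 : ℝ) 1) → (∀ t, r' t ∈ Set.Icc (0 : ℝ) 1) →
    Neighbouring r r' → π a r ≤ Real.exp ε * π a r'

/-- The value of a binary reward. -/
def rewardValue (b : Bool) : ℝ := if b then 1 else 0

/-- The mass that the Bernoulli distribution of mean `p` gives to the reward `b`. -/
def bernoulliMass (p : ℝ) (b : Bool) : ℝ := if b then p else 1 - p

/-- Canonical bandit model for the Bernoulli environment with means `μ`: the probability of the
history with actions `a` and rewards `b` is `π(a^T ∣ b^T) ∏ₜ ν_{a_t}(b_t)`. -/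
def historyProb {K T : ℕ} (π : ActionLaw K T) (μ : Fin K → ℝ)
    (a : Fin T → Fin K) (b : Fin T → Bool) : ℝ :=
  π a (fun t => rewardValue (b t)) * ∏ t, bernoulliMass (μ (a t)) (b t)

/-- The largest mean `μ*`. -/
def bestMean {K : ℕ} (μ : Fin K → ℝ) : ℝ := ⨆ a, μ a

/-- The suboptimality gap `Δ_a = μ* - μ_a`. -/
def gap {K : ℕ} (μ : Fin K → ℝ) (a : Fin K) : ℝ := bestMean μ - μ a

/-- The regret `T μ* - 𝔼[∑ₜ R_t]`. -/
def regret {K T : ℕ} (π : ActionLaw K T) (μ : Fin K → ℝ) : ℝ :=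
  T * bestMean μ -
    ∑ a : Fin T → Fin K, ∑ b : Fin T → Bool, historyProb π μ a b * ∑ t, rewardValue (b t)

/-! ### The algorithm AdaP-KLUCB -/

/-- Memory of the algorithm between two rounds. -/
structure State (K : ℕ) where
  /-- `N_a`: number of times that arm `a` has been played -/
  pulls : Fin K → ℕ
  /-- value of `N_a` just before the last active episode of arm `a` -/
  start : Fin K → ℕ
  /-- sum of the rewards collected in the last active episode of arm `a` -/
  sum : Fin K → ℝ
  /-- the arm of the running episode, `none` if the next round opens a new episode -/
  current : Option (Fin K)

def initialState (K : ℕ) : State K := ⟨fun _ => 0, fun _ => 0, fun _ => 0, none⟩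

/-- Clipping to `[0, 1]`. -/
def clip (x : ℝ) : ℝ := min (max 0 x) 1

/-- The KL-UCB index at round `t` of an arm that was played `N` times and whose private mean is
`m`. -/
def klIndex (ε α : ℝ) (t N : ℕ) (m : ℝ) : ℝ :=
  sSup {q : ℝ | q ∈ Set.Icc (0 : ℝ) 1 ∧
    klBer (clip (m + α * Real.log t / (ε * (1 / 2 * N)))) q
      ≤ ((α * Real.log t / (1 / 2 * N) : ℝ) : EReal)}

/-- Private mean of arm `a`: the empirical mean over its last active episode plus the noise drawn
for that episode. Outside a running episode `N_a` is a power `2 ^ k` of two, and `Z (a, k)` is the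
noise drawn once, when `N_a` reaches this value. -/
def privateMean {K : ℕ} (Z : Fin K × ℕ → ℝ) (s : State K) (a : Fin K) : ℝ :=
  s.sum a / ((s.pulls a : ℝ) - s.start a) + Z (a, Nat.log 2 (s.pulls a))

/-- The arm played after `t` completed rounds, i.e. in round number `t + 1`: first every arm once,
then the arm of the running episode, or, at the opening of an episode, an arm of largest index. -/
def chooseArm {K : ℕ} (ε α : ℝ) (sel : (Fin K → ℝ) → Fin K) (Z : Fin K × ℕ → ℝ)
    (s : State K) (t : ℕ) : Fin K :=
  if h : t < K then ⟨t, h⟩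
  else match s.current with
    | some b => b
    | none => sel fun a => klIndex ε α (t + 1) (s.pulls a) (privateMean Z s a)

/-- Update after arm `b` was played with reward `x`. The episode goes on until the number of pulls
of `b` is twice what it was when the episode was opened. -/
def updateState {K : ℕ} (s : State K) (b : Fin K) (x : ℝ) : State K :=
  let start' : Fin K → ℕ :=
    if s.current = none then Function.update s.start b (s.pulls b) else s.start
  let sum' : Fin K → ℝ := if s.current = none then Function.update s.sum b 0 else s.sum
  { pulls := Function.update s.pulls b (s.pulls b + 1)
    start := start'
    sum := Function.update sum' b (sum' b + x)
    current := if s.pulls b + 1 < 2 * start' b then some b else none }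

/-- The memory after `t` rounds, for noise `Z` and rewards `r 0, …, r (t - 1)`. -/
def runState {K : ℕ} (ε α : ℝ) (sel : (Fin K → ℝ) → Fin K) (Z : Fin K × ℕ → ℝ) (r : ℕ → ℝ) :
    ℕ → State K
  | 0 => initialState K
  | t + 1 =>
    let s := runState ε α sel Z r t
    updateState s (chooseArm ε α sel Z s t) (r t)

/-- The arm played after `t` completed rounds. -/
def runAction {K : ℕ} (ε α : ℝ) (sel : (Fin K → ℝ) → Fin K) (Z : Fin K × ℕ → ℝ) (r : ℕ → ℝ)
    (t : ℕ) : Fin K :=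
  chooseArm ε α sel Z (runState ε α sel Z r t) t

/-- Law of the noise: independent, with `Z (a, k)` of law `Lap(2 / (ε N))` for `N = 2 ^ k`. -/
def noiseLaw (K : ℕ) (ε : ℝ) : Measure (Fin K × ℕ → ℝ) :=
  Measure.infinitePi fun p => laplace (2 / (ε * 2 ^ p.2))

/-- `sel` returns an arm of largest index, ties being broken in a measurable way. -/
def IsArgmaxRule {K : ℕ} (sel : (Fin K → ℝ) → Fin K) : Prop :=
  Measurable sel ∧ ∀ (x : Fin K → ℝ) (a : Fin K), x a ≤ x (sel x)

/-- The action law of AdaP-KLUCB over `T` rounds. -/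
def adaPKLUCB (K : ℕ) (ε α : ℝ) (sel : (Fin K → ℝ) → Fin K) (T : ℕ) : ActionLaw K T :=
  fun a r => (noiseLaw K ε).real
    {Z | ∀ t : Fin T,
      runAction ε α sel Z (fun n => if h : n < T then r ⟨n, h⟩ else 0) t = a t}

end PrivateBandit

end

/-!
Privacy. Every reward enters the algorithm through the empirical mean of a single episode, and an
episode that ends after `2 ^ k` plays of its arm has at least `2 ^ k / 2` rounds. Replacing one
reward therefore has the same effect as shifting one Laplace variable of scale `2 / (ε 2 ^ k)` by at
most `2 / 2 ^ k`, and such a shift changes the density by a factor of at most `e ^ ε`.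

Regret. Drawing the rewards of each arm in advance from a table does not change the law of the
history. The episode structure makes the number of plays of an arm at the start of an episode a
power of two, so an arm played more than `2 ^ k` times has opened an episode with exactly `2 ^ k`
plays behind it. At that moment either the index of an optimal arm is below the optimal mean, or
the index of the chosen arm is not. Both events concern one table block and one noise variable for
each dyadic scale; Chernoff and Laplace tails bound their probabilities, and these are summed with
weights `2 ^ k`.

With `D = min {d(μ_c, μ*), 6 ε Δ_c}` and `x = α log T`, a suboptimal arm `c` falls into one of two
regimes. If `D ≤ 96 x (1 - μ_c)`, its index is too large beyond the scale `2 ^ k ≈ x / D` only when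
its empirical mean or its noise deviates by a constant fraction of the gap. Otherwise its index is
too large only when all rewards of the block are `1` or the noise is of order `2 ^ (-k)`, and two
consecutive blocks of ones are rare enough for a bound on `(1 - μ_c) 𝔼[N_c]` that is free of `T`.
-/

noncomputable section

open MeasureTheory ProbabilityTheory

namespace PrivateBandit

/-! ### Bernoulli relative entropy -/

theorem mul_log_div_self (x : ℝ) : x * Real.log (x / x) = 0 := by
  rcases eq_or_ne x 0 with rfl | hx
  · rw [zero_mul]
  · rw [div_self hx, Real.log_one, mul_zero]

theorem mul_log_div (x : ℝ) {y : ℝ} (hy : y ≠ 0) :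
    x * Real.log (x / y) = x * Real.log x - x * Real.log y := by
  rcases eq_or_ne x 0 with rfl | hx
  · simp
  · rw [Real.log_div hx hy, mul_sub]

theorem sub_le_mul_log_div {x y : ℝ} (hx : 0 ≤ x) (hy : 0 < y) : x - y ≤ x * Real.log (x / y) := by
  rcases hx.eq_or_lt with rfl | hx
  · simpa using hy.le
  · calc x - y = x * (1 - (x / y)⁻¹) := by field_simp
      _ ≤ _ := mul_le_mul_of_nonneg_left (Real.one_sub_inv_le_log_of_pos (div_pos hx hy)) hx.le

theorem mul_log_div_le {x y : ℝ} (hx : 0 ≤ x) (hy : 0 < y) :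
    x * Real.log (x / y) ≤ x * (x / y - 1) := by
  rcases hx.eq_or_lt with rfl | hx
  · rw [zero_mul, zero_mul]
  · exact mul_le_mul_of_nonneg_left (Real.log_le_sub_one_of_pos (div_pos hx hy)) hx.le

theorem mul_log_div_convexComb_le {x y t : ℝ} (hx : 0 ≤ x) (hy : 0 < y) (ht : t ∈ Set.Icc 0 1) :
    x * Real.log (x / ((1 - t) * x + t * y)) ≤ t * (x * Real.log (x / y)) := by
  rcases hx.eq_or_lt with rfl | hx
  · simp
  have hlog : (1 - t) * Real.log x + t * Real.log y ≤ Real.log ((1 - t) * x + t * y) :=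
    strictConcaveOn_log_Ioi.concaveOn.2 hx hy (sub_nonneg.2 ht.2) ht.1 (sub_add_cancel 1 t)
  have hcomb : 0 < (1 - t) * x + t * y :=
    (convex_Ioi (0 : ℝ)) hx hy (sub_nonneg.2 ht.2) ht.1 (sub_add_cancel 1 t)
  rw [Real.log_div hx.ne' hcomb.ne', Real.log_div hx.ne' hy.ne']
  linear_combination x * hlog

theorem add_sq_sqrt_sub_sqrt_le_mul_log_div {x y : ℝ} (hx : 0 < x) (hy : 0 < y) :
    x - y + (√x - √y) ^ 2 ≤ x * Real.log (x / y) := by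
  have hlog := Real.one_sub_inv_le_log_of_pos (Real.sqrt_pos.2 (div_pos hx hy))
  rw [Real.log_sqrt (div_pos hx hy).le, Real.sqrt_div hx.le, inv_div] at hlog
  have hmul : x * (√y / √x) = √x * √y := by
    have := Real.sqrt_pos.2 hx
    nth_rewrite 1 [← Real.mul_self_sqrt hx.le]
    field_simp
  calc x - y + (√x - √y) ^ 2 = x * (2 * (1 - √y / √x)) := by
        linear_combination Real.sq_sqrt hx.le + Real.sq_sqrt hy.le + 2 * hmul
    _ ≤ x * Real.log (x / y) := mul_le_mul_of_nonneg_left (by linarith) hx.le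

theorem sq_sub_div_le_sq_sqrt_sub_sqrt {x y z : ℝ} (hx : 0 ≤ x) (hy : 0 ≤ y) (hz : 0 < z)
    (hxz : x ≤ z) (hyz : y ≤ z) : (x - y) ^ 2 / (4 * z) ≤ (√x - √y) ^ 2 := by
  have hfactor : (x - y) ^ 2 = (√x - √y) ^ 2 * (√x + √y) ^ 2 := by
    rw [← mul_pow]
    congr 1
    linear_combination -Real.sq_sqrt hx + Real.sq_sqrt hy
  rw [div_le_iff₀ (by positivity), hfactor]
  refine mul_le_mul_of_nonneg_left ?_ (sq_nonneg _)
  nlinarith [Real.sq_sqrt hx, Real.sq_sqrt hy, sq_nonneg (√x - √y)]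

/-- The real-valued formula for the relative entropy between the Bernoulli distributions of means
`p` and `q`. It agrees with `klBer p q` for `q ∉ {0, 1}`; for `q ∈ {0, 1}` it may be a junk
value. -/
def klReal (p q : ℝ) : ℝ := p * Real.log (p / q) + (1 - p) * Real.log ((1 - p) / (1 - q))

theorem klReal_eq_sub_binEntropy (p : ℝ) {q : ℝ} (hq : q ≠ 0) (hq1 : q ≠ 1) :
    klReal p q = -p * Real.log q - (1 - p) * Real.log (1 - q) - Real.binEntropy p := by
  rw [klReal, mul_log_div p hq, mul_log_div (1 - p) (sub_ne_zero.2 hq1.symm), Real.binEntropy,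
    Real.log_inv, Real.log_inv]
  ring

theorem klReal_self (p : ℝ) : klReal p p = 0 := by
  rw [klReal, mul_log_div_self, mul_log_div_self, add_zero]

theorem klReal_nonneg {p q : ℝ} (hp : 0 ≤ p) (hp1 : p ≤ 1) (hq : 0 < q) (hq1 : q < 1) :
    0 ≤ klReal p q := by
  have hleft := sub_le_mul_log_div hp hq
  have hright := sub_le_mul_log_div (sub_nonneg.2 hp1) (sub_pos.2 hq1)
  rw [klReal]
  linarith

theorem klReal_sub_klReal (p : ℝ) {q q' : ℝ} (hq : q ≠ 0) (hq1 : q ≠ 1) (hq' : q' ≠ 0)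
    (hq1' : q' ≠ 1) :
    klReal p q' - klReal p q = p * Real.log (q / q') + (1 - p) * Real.log ((1 - q) / (1 - q')) := by
  rw [klReal_eq_sub_binEntropy p hq' hq1', klReal_eq_sub_binEntropy p hq hq1,
    Real.log_div hq hq', Real.log_div (sub_ne_zero.2 hq1.symm) (sub_ne_zero.2 hq1'.symm)]
  ring

theorem klReal_sub_klReal_anti {p p' q q' : ℝ} (hpp : p ≤ p') (hq : 0 < q) (hqq : q ≤ q')
    (hq1 : q' < 1) : klReal p' q' - klReal p' q ≤ klReal p q' - klReal p q := by
  have hq' : 0 < q' := hq.trans_le hqq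
  have hlog : Real.log (q / q') ≤ 0 := Real.log_nonpos (by positivity) ((div_le_one hq').2 hqq)
  have hlog_one_sub : 0 ≤ Real.log ((1 - q) / (1 - q')) :=
    Real.log_nonneg ((one_le_div (by linarith)).2 (by linarith))
  rw [klReal_sub_klReal p' hq.ne' (hqq.trans_lt hq1).ne hq'.ne' hq1.ne,
    klReal_sub_klReal p hq.ne' (hqq.trans_lt hq1).ne hq'.ne' hq1.ne]
  nlinarith

theorem klReal_mono_right {p q q' : ℝ} (hpq : p ≤ q) (hq : 0 < q) (hqq : q ≤ q') (hq1 : q' < 1) :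
    klReal p q ≤ klReal p q' := by
  have hdiff := klReal_sub_klReal_anti hpq hq hqq hq1
  have hnonneg := klReal_nonneg hq.le (hqq.trans hq1.le) (hq.trans_le hqq) hq1
  rw [klReal_self] at hdiff
  linarith

theorem klReal_anti_left {p p' q : ℝ} (hp : 0 ≤ p) (hpp : p ≤ p') (hpq : p' ≤ q) (hq1 : q < 1) :
    klReal p' q ≤ klReal p q := by
  rcases (hp.trans hpp).eq_or_lt with rfl | hp'
  · rw [le_antisymm hpp hp]
  · have hdiff := klReal_sub_klReal_anti hpp hp' hpq hq1
    have hnonneg := klReal_nonneg hp (hpp.trans (hpq.trans hq1.le)) hp' (hpq.trans_lt hq1)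
    rw [klReal_self] at hdiff
    linarith

theorem klReal_convexComb_le {p q t : ℝ} (hp : 0 ≤ p) (hp1 : p ≤ 1) (hq : 0 < q) (hq1 : q < 1)
    (ht : t ∈ Set.Icc 0 1) : klReal p ((1 - t) * p + t * q) ≤ t * klReal p q := by
  have hleft := mul_log_div_convexComb_le hp hq ht
  have hright := mul_log_div_convexComb_le (sub_nonneg.2 hp1) (sub_pos.2 hq1) ht
  rw [show (1 - t) * (1 - p) + t * (1 - q) = 1 - ((1 - t) * p + t * q) by ring] at hright
  rw [klReal, klReal]
  linarith

/-- Let `w = (p + 3 q) / 4`. By convexity, replacing `q` by `w` lowers `klReal p q` by at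
least a quarter, and the amount lost is affine in the first argument, where the midpoint of `p` and
`q` is `(p + 2 w) / 3`. -/
theorem klReal_le_klReal_midpoint {p q : ℝ} (hp : 0 ≤ p) (hpq : p < q) (hq1 : q < 1) :
    klReal p q ≤ 12 * klReal ((p + q) / 2) q := by
  have hconv : klReal p ((p + 3 * q) / 4) ≤ 3 / 4 * klReal p q := by
    convert klReal_convexComb_le (t := 3 / 4) hp (hpq.trans hq1).le (hp.trans_lt hpq) hq1
      (by norm_num) using 2
    ring
  obtain ⟨w, hw⟩ : ∃ w, w = (p + 3 * q) / 4 := ⟨_, rfl⟩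
  obtain ⟨m, hm⟩ : ∃ m, m = (p + q) / 2 := ⟨_, rfl⟩
  have cost (x : ℝ) := klReal_sub_klReal x (q := w) (q' := q) (by linarith) (by linarith)
    (by linarith) hq1.ne
  have haffine : 3 * (klReal m q - klReal m w) =
      (klReal p q - klReal p w) + 2 * (klReal w q - klReal w w) := by
    rw [cost, cost, cost, show m = (p + 2 * w) / 3 by rw [hm, hw]; ring]
    ring
  have hw_nonneg := klReal_nonneg (p := w) (q := q) (by linarith) (by linarith) (by linarith) hq1
  have hm_nonneg := klReal_nonneg (p := m) (q := w) (by linarith) (by linarith) (by linarith)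
    (by linarith)
  rw [klReal_self] at haffine
  rw [← hw] at hconv
  rw [← hm]
  linarith

theorem klReal_le_sq_div {p q : ℝ} (hp : 0 ≤ p) (hp1 : p ≤ 1) (hq : 0 < q) (hq1 : q < 1) :
    klReal p q ≤ (q - p) ^ 2 / (q * (1 - q)) := by
  have hq1' : 1 - q ≠ 0 := by linarith
  calc klReal p q ≤ p * (p / q - 1) + (1 - p) * ((1 - p) / (1 - q) - 1) :=
        add_le_add (mul_log_div_le hp hq) (mul_log_div_le (sub_nonneg.2 hp1) (sub_pos.2 hq1))
    _ = (q - p) ^ 2 / (q * (1 - q)) := by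
        field_simp
        ring

theorem klReal_le_mul_log {p q : ℝ} (hp : 0 ≤ p) (hpq : p ≤ q) :
    klReal p q ≤ (1 - p) * Real.log ((1 - p) / (1 - q)) :=
  add_le_of_nonpos_left (mul_nonpos_of_nonneg_of_nonpos hp
    (Real.log_nonpos (div_nonneg hp (hp.trans hpq)) (div_le_one_of_le₀ hpq (hp.trans hpq))))

/-- By comparison with the squared Hellinger distance. -/
theorem sq_div_le_klReal {p q : ℝ} (hq : 0 < q) (hqp : q ≤ p) (hp1 : p < 1) :
    (p - q) ^ 2 / (4 * (p * (1 - q))) ≤ klReal p q := by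
  have hp : 0 < p := hq.trans_le hqp
  have hq1 : 0 < 1 - q := by linarith
  have hp1' : 0 < 1 - p := by linarith
  have hsum : (p - q) ^ 2 / (4 * (p * (1 - q))) ≤
      (p - q) ^ 2 / (4 * p) + (1 - p - (1 - q)) ^ 2 / (4 * (1 - q)) := by
    rw [show (p - q) ^ 2 / (4 * p) + (1 - p - (1 - q)) ^ 2 / (4 * (1 - q)) =
      (p - q) ^ 2 * (1 + (p - q)) / (4 * (p * (1 - q))) by field_simp; ring]
    gcongr
    nlinarith [mul_nonneg (sq_nonneg (p - q)) (sub_nonneg.2 hqp)]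
  have hleft := add_sq_sqrt_sub_sqrt_le_mul_log_div hp hq
  have hright := add_sq_sqrt_sub_sqrt_le_mul_log_div hp1' hq1
  have hleft' := sq_sub_div_le_sq_sqrt_sub_sqrt hp.le hq.le hp le_rfl hqp
  have hright' := sq_sub_div_le_sq_sqrt_sub_sqrt hp1'.le hq1.le hq1 (by linarith) le_rfl
  rw [klReal]
  linarith

theorem continuous_klReal_left {q : ℝ} (hq : q ≠ 0) (hq1 : q ≠ 1) :
    Continuous fun p => klReal p q := by
  simp only [klReal_eq_sub_binEntropy _ hq hq1]
  have := Real.binEntropy_continuous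
  fun_prop

theorem continuousAt_klReal_right (p : ℝ) {q : ℝ} (hq : q ≠ 0) (hq1 : q ≠ 1) :
    ContinuousAt (klReal p) q := by
  have hformula : ContinuousAt
      (fun z => -p * Real.log z - (1 - p) * Real.log (1 - z) - Real.binEntropy p) q := by
    have : 1 - q ≠ 0 := sub_ne_zero.2 hq1.symm
    fun_prop (disch := assumption)
  refine hformula.congr ?_
  filter_upwards [isOpen_ne.mem_nhds hq, isOpen_ne.mem_nhds hq1] with z hz hz1
  exact (klReal_eq_sub_binEntropy p hz hz1).symm

theorem tendsto_klReal_nhdsLT_one {p : ℝ} (hp : p < 1) :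
    Filter.Tendsto (klReal p) (nhdsWithin 1 (Set.Iio 1)) Filter.atTop := by
  have hsub : Filter.Tendsto (fun z : ℝ => 1 - z) (nhdsWithin 1 (Set.Iio 1))
      (nhdsWithin 0 (Set.Ioi 0)) := by
    refine tendsto_nhdsWithin_iff.2 ⟨?_, ?_⟩
    · exact ((continuous_const.sub continuous_id).tendsto' 1 0 (sub_self 1)).mono_left
        nhdsWithin_le_nhds
    · filter_upwards [self_mem_nhdsWithin] with z hz using sub_pos.2 (Set.mem_Iio.1 hz)
  have hdiverges := (Real.tendsto_log_nhdsGT_zero.comp hsub).const_mul_atBot_of_neg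
    (sub_neg.2 hp)
  have hbounded : ContinuousAt (fun z => -p * Real.log z - Real.binEntropy p) 1 := by
    have : (1 : ℝ) ≠ 0 := one_ne_zero
    fun_prop (disch := assumption)
  refine ((hbounded.tendsto.mono_left nhdsWithin_le_nhds).add_atTop hdiverges).congr' ?_
  filter_upwards [Ioo_mem_nhdsLT zero_lt_one] with z hz
  rw [klReal_eq_sub_binEntropy p hz.1.ne' hz.2.ne, Function.comp_apply]
  ring

theorem klBer_eq_klReal (p : ℝ) {q : ℝ} (hq : q ≠ 0) (hq1 : q ≠ 1) :
    klBer p q = (klReal p q : EReal) := by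
  rw [klBer, if_neg (by tauto), klReal]

theorem klBer_one {p : ℝ} (hp : p ≠ 1) : klBer p 1 = ⊤ :=
  if_pos (Or.inr ⟨rfl, hp⟩)

theorem klBer_zero {p : ℝ} (hp : p ≠ 0) : klBer p 0 = ⊤ :=
  if_pos (Or.inl ⟨rfl, hp⟩)

theorem klBer_self (p : ℝ) : klBer p p = 0 := by
  rw [klBer, if_neg (by tauto), ← klReal, klReal_self, EReal.coe_zero]

theorem klBer_nonneg {p q : ℝ} (hp : 0 ≤ p) (hp1 : p ≤ 1) (hq : 0 ≤ q) (hq1 : q ≤ 1) :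
    0 ≤ klBer p q := by
  rcases eq_or_ne p q with rfl | hne
  · rw [klBer_self]
  rcases hq.eq_or_lt with rfl | hq
  · exact (klBer_zero hne).symm ▸ le_top
  rcases hq1.eq_or_lt with rfl | hq1
  · exact (klBer_one hne).symm ▸ le_top
  rw [klBer_eq_klReal p hq.ne' hq1.ne]
  exact_mod_cast klReal_nonneg hp hp1 hq hq1

theorem klBer_anti_left {p p' q : ℝ} (hp : 0 ≤ p) (hpp : p ≤ p') (hpq : p' ≤ q) (hq1 : q ≤ 1) :
    klBer p' q ≤ klBer p q := by
  rcases hpp.eq_or_lt with rfl | hlt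
  · rfl
  rcases hq1.eq_or_lt with rfl | hq1
  · exact (klBer_one (hlt.trans_le hpq).ne).symm ▸ le_top
  have hq : q ≠ 0 := (hp.trans_lt (hlt.trans_le hpq)).ne'
  rw [klBer_eq_klReal p' hq hq1.ne, klBer_eq_klReal p hq hq1.ne]
  exact_mod_cast klReal_anti_left hp hpp hpq hq1

theorem klBer_mono_right {p q q' : ℝ} (hp : 0 ≤ p) (hpq : p ≤ q) (hqq : q ≤ q') (hq1 : q' ≤ 1) :
    klBer p q ≤ klBer p q' := by
  rcases hpq.eq_or_lt with rfl | hlt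
  · exact (klBer_self p).symm ▸ klBer_nonneg hp (hqq.trans hq1) (hp.trans hqq) hq1
  rcases hq1.eq_or_lt with rfl | hq1
  · exact (klBer_one (hlt.trans_le hqq).ne).symm ▸ le_top
  have hq : 0 < q := hp.trans_lt hlt
  rw [klBer_eq_klReal p hq.ne' (hqq.trans_lt hq1).ne,
    klBer_eq_klReal p (hq.trans_le hqq).ne' hq1.ne]
  exact_mod_cast klReal_mono_right hpq hq hqq hq1

theorem klBer_le_of_forall_lt {p q b : ℝ} (hp : 0 ≤ p) (hpq : p < q) (hq : q ≤ 1)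
    (h : ∀ z ∈ Set.Ioo p q, klBer p z ≤ (b : EReal)) : klBer p q ≤ (b : EReal) := by
  have hle : ∀ᶠ z in nhdsWithin q (Set.Iio q), klReal p z ≤ b := by
    filter_upwards [Ioo_mem_nhdsLT hpq] with z hz
    rw [← EReal.coe_le_coe_iff,
      ← klBer_eq_klReal p (hp.trans_lt hz.1).ne' (hz.2.trans_le hq).ne]
    exact h z hz
  rcases hq.eq_or_lt with rfl | hq1
  · obtain ⟨z, hz, hbz⟩ :=
      (hle.and ((tendsto_klReal_nhdsLT_one hpq).eventually_gt_atTop b)).exists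
    exact absurd hz hbz.not_ge
  · have hq0 : q ≠ 0 := (hp.trans_lt hpq).ne'
    rw [klBer_eq_klReal p hq0 hq1.ne, EReal.coe_le_coe_iff]
    exact le_of_tendsto
      ((continuousAt_klReal_right p hq0 hq1.ne).tendsto.mono_left nhdsWithin_le_nhds) hle

/-! ### The index -/

theorem clip_mem (x : ℝ) : clip x ∈ Set.Icc (0 : ℝ) 1 :=
  ⟨le_min (le_max_left _ _) zero_le_one, min_le_right _ _⟩

theorem monotone_clip : Monotone clip := fun _ _ h => min_le_min_right _ (max_le_max_left _ h)

theorem clip_of_mem {x : ℝ} (hx : x ∈ Set.Icc (0 : ℝ) 1) : clip x = x := by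
  rw [clip, max_eq_right hx.1, min_eq_left hx.2]

theorem clip_le_of_nonneg {x : ℝ} (hx : 0 ≤ x) : clip x ≤ x := by
  rw [clip, max_eq_right hx]
  exact min_le_left _ _

/-- The relative entropy ball of radius `b` around `p`: the means `q ∈ [0, 1]` with
`d(p, q) ≤ b`. -/
def klBall (p b : ℝ) : Set ℝ := {q | q ∈ Set.Icc (0 : ℝ) 1 ∧ klBer p q ≤ (b : EReal)}

/-- The largest `q` whose relative entropy from `p` is at most `b`; the KL-UCB index is of this
form. It is the junk value `0` for `b < 0`, where there is no such `q`. -/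
def klUpper (p b : ℝ) : ℝ := sSup (klBall p b)

theorem klIndex_eq_klUpper (ε α : ℝ) (t N : ℕ) (m : ℝ) :
    klIndex ε α t N m = klUpper (clip (m + α * Real.log t / (ε * (1 / 2 * N))))
      (α * Real.log t / (1 / 2 * N)) := rfl

theorem le_klUpper {p b q : ℝ} (hq : q ∈ klBall p b) : q ≤ klUpper p b :=
  le_csSup ⟨1, fun _ h => h.1.2⟩ hq

theorem self_mem_klBall {p b : ℝ} (hp : p ∈ Set.Icc (0 : ℝ) 1) (hb : 0 ≤ b) : p ∈ klBall p b :=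
  ⟨hp, by rw [klBer_self]; exact_mod_cast hb⟩

theorem radius_nonneg_of_mem_klBall {p b q : ℝ} (hp : p ∈ Set.Icc (0 : ℝ) 1)
    (hq : q ∈ klBall p b) : 0 ≤ b := by
  exact_mod_cast (klBer_nonneg hp.1 hp.2 hq.1.1 hq.1.2).trans hq.2

theorem lt_klBer_of_klUpper_lt {p b q : ℝ} (hp : p ∈ Set.Icc (0 : ℝ) 1) (hb : 0 ≤ b)
    (hq : q ∈ Set.Icc (0 : ℝ) 1) (h : klUpper p b < q) : p < q ∧ (b : EReal) < klBer p q :=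
  ⟨(le_klUpper (self_mem_klBall hp hb)).trans_lt h,
    not_le.1 fun hle => (le_klUpper ⟨hq, hle⟩).not_gt h⟩

theorem klBer_le_of_le_klUpper {p b q : ℝ} (hp : p ∈ Set.Icc (0 : ℝ) 1) (hb : 0 ≤ b)
    (hq : q ≤ 1) (h : q ≤ klUpper p b) : q ≤ p ∨ klBer p q ≤ (b : EReal) := by
  refine (le_or_gt q p).imp_right fun hpq => klBer_le_of_forall_lt hp.1 hpq hq fun z hz => ?_
  obtain ⟨y, hy, hzy⟩ := exists_lt_of_lt_csSup ⟨p, self_mem_klBall hp hb⟩ (hz.2.trans_le h)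
  exact (klBer_mono_right hp.1 hz.1.le hzy.le hy.1.2).trans hy.2

theorem klUpper_mono_left {p p' : ℝ} (b : ℝ) (hp : p ∈ Set.Icc (0 : ℝ) 1)
    (hp' : p' ∈ Set.Icc (0 : ℝ) 1) (h : p ≤ p') : klUpper p b ≤ klUpper p' b := by
  refine Real.sSup_le (fun q hq => ?_) (Real.sSup_nonneg fun q hq => hq.1.1)
  rcases le_or_gt q p' with hqp | hpq
  · exact hqp.trans (le_klUpper (self_mem_klBall hp' (radius_nonneg_of_mem_klBall hp hq)))
  · exact le_klUpper ⟨hq.1, (klBer_anti_left hp.1 h hpq.le hq.1.2).trans hq.2⟩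

theorem monotone_klIndex (ε α : ℝ) (t N : ℕ) : Monotone (klIndex ε α t N) := fun m m' h => by
  rw [klIndex_eq_klUpper, klIndex_eq_klUpper]
  exact klUpper_mono_left _ (clip_mem _) (clip_mem _) (monotone_clip (by linarith))

/-! ### Laplace noise -/

theorem laplace_real_Ioi {b s : ℝ} (hb : 0 < b) (hs : 0 ≤ s) :
    (laplace b).real (Set.Ioi s) = Real.exp (-s / b) / 2 := by
  have hdensity : Set.EqOn (fun x : ℝ => Real.exp (-|x| / b) / (2 * b))
      (fun x : ℝ => Real.exp (-b⁻¹ * x) / (2 * b)) (Set.Ioi s) := fun x hx => by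
    beta_reduce
    rw [abs_of_nonneg (hs.trans (Set.mem_Ioi.1 hx).le), neg_mul, inv_mul_eq_div, neg_div]
  have hneg : -b⁻¹ < 0 := neg_lt_zero.mpr (inv_pos.mpr hb)
  have hint : IntegrableOn (fun x : ℝ => Real.exp (-|x| / b) / (2 * b)) (Set.Ioi s) :=
    IntegrableOn.congr_fun ((integrableOn_exp_mul_Ioi hneg s).div_const _) hdensity.symm
      measurableSet_Ioi
  rw [measureReal_def, laplace, withDensity_apply _ measurableSet_Ioi,
    ← ofReal_integral_eq_lintegral_ofReal hint (Filter.Eventually.of_forall fun x => by positivity),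
    ENNReal.toReal_ofReal (integral_nonneg fun x => by positivity),
    setIntegral_congr_fun measurableSet_Ioi hdensity, integral_div, integral_exp_mul_Ioi hneg,
    show -b⁻¹ * s = -s / b by ring]
  field_simp

theorem map_neg_laplace (b : ℝ) : (laplace b).map Neg.neg = laplace b := by
  refine Measure.ext fun S hS => ?_
  rw [Measure.map_apply measurable_neg hS, laplace, withDensity_apply _ (measurable_neg hS),
    withDensity_apply _ hS,
    ← (Measure.measurePreserving_neg (volume : Measure ℝ)).setLIntegral_comp_preimage hS
      (by fun_prop)]
  simp only [abs_neg]

theorem laplace_real_Iio {b s : ℝ} (hb : 0 < b) (hs : 0 ≤ s) :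
    (laplace b).real (Set.Iio (-s)) = Real.exp (-s / b) / 2 := by
  rw [← laplace_real_Ioi hb hs, ← map_neg_laplace, map_measureReal_apply measurable_neg
    measurableSet_Iio, Set.neg_preimage, Set.neg_Iio, neg_neg, map_neg_laplace]

theorem laplace_le_smul_map_add {b c δ : ℝ} (hb : 0 < b) (hδ : |δ| / b ≤ c) :
    laplace b ≤ ENNReal.ofReal (Real.exp c) • (laplace b).map (fun x => x + δ) := by
  refine Measure.le_iff.2 fun S hS => ?_
  have hadd : Measurable fun x : ℝ => x + δ := by fun_prop
  have hshift := (measurePreserving_add_right (volume : Measure ℝ) δ).setLIntegral_comp_preimage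
    (s := S) (f := fun x => ENNReal.ofReal (Real.exp (-|x - δ| / b) / (2 * b))) hS (by fun_prop)
  simp only [add_sub_cancel_right] at hshift
  rw [Measure.smul_apply, Measure.map_apply hadd hS, laplace, withDensity_apply _ hS,
    withDensity_apply _ (hadd hS), smul_eq_mul, hshift, ← lintegral_const_mul _ (by fun_prop)]
  refine lintegral_mono fun x => ?_
  rw [← ENNReal.ofReal_mul (Real.exp_pos _).le]
  refine ENNReal.ofReal_le_ofReal ?_
  rw [← mul_div_assoc, ← Real.exp_add]
  gcongr
  have habs : |x - δ| ≤ |x| + |δ| := abs_sub x δ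
  calc -|x| / b ≤ |δ| / b + -|x - δ| / b := by
        rw [← add_div]
        gcongr
        linarith
    _ ≤ c + -|x - δ| / b := by gcongr

section InfinitePi

variable {ι : Type*} {X : ι → Type*} [∀ i, MeasurableSpace (X i)] {μ ν : ∀ i, Measure (X i)}
  [∀ i, IsProbabilityMeasure (μ i)] [∀ i, IsProbabilityMeasure (ν i)] {j : ι}

theorem map_update_prod_infinitePi [DecidableEq ι] (h : ∀ i, i ≠ j → μ i = ν i) :
    ((Measure.infinitePi ν).prod (μ j)).map (fun x => Function.update x.1 j x.2) =
      Measure.infinitePi μ := by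
  refine Measure.eq_infinitePi μ fun s t ht => ?_
  have hpreimage : (fun x : (∀ i, X i) × X j => Function.update x.1 j x.2) ⁻¹' ((s : Set ι).pi t) =
      ((s.erase j : Finset ι) : Set ι).pi t ×ˢ (if j ∈ s then t j else Set.univ) := by
    ext x
    simp only [Set.mem_preimage, Set.mem_pi, Set.mem_prod, Finset.mem_coe, Finset.mem_erase]
    refine ⟨fun hx => ⟨fun i hi => ?_, ?_⟩, fun hx i hi => ?_⟩
    · simpa only [Function.update_of_ne hi.1] using hx i hi.2
    · split_ifs with hj
      · simpa only [Function.update_self] using hx j hj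
      · trivial
    · rcases eq_or_ne i j with rfl | hij
      · simpa only [Function.update_self, if_pos hi] using hx.2
      · simpa only [Function.update_of_ne hij] using hx.1 i ⟨hij, hi⟩
  have hprod : ∏ i ∈ s.erase j, ν i (t i) = ∏ i ∈ s.erase j, μ i (t i) :=
    Finset.prod_congr rfl fun i hi => by rw [h i (Finset.ne_of_mem_erase hi)]
  rw [Measure.map_apply measurable_update' (.pi s.countable_toSet fun _ _ => ht _), hpreimage,
    Measure.prod_prod, Measure.infinitePi_pi _ (fun i _ => ht i), hprod]
  by_cases hj : j ∈ s
  · rw [if_pos hj, Finset.prod_erase_mul s (fun i => μ i (t i)) hj]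
  · rw [if_neg hj, measure_univ, mul_one, Finset.erase_eq_of_notMem hj]

theorem infinitePi_le_smul_infinitePi {c : ENNReal} (h : ∀ i, i ≠ j → μ i = ν i)
    (hj : μ j ≤ c • ν j) : Measure.infinitePi μ ≤ c • Measure.infinitePi ν := by
  classical
  calc Measure.infinitePi μ
      = ((Measure.infinitePi ν).prod (μ j)).map fun x => Function.update x.1 j x.2 :=
        (map_update_prod_infinitePi h).symm
    _ ≤ ((Measure.infinitePi ν).prod (c • ν j)).map fun x => Function.update x.1 j x.2 :=
        Measure.map_mono (Measure.prod_mono le_rfl hj) measurable_update'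
    _ = c • Measure.infinitePi ν := by
        rw [Measure.prod_smul_right, Measure.map_smul, map_update_prod_infinitePi fun _ _ => rfl]

end InfinitePi

section NoiseLaw

variable {K : ℕ} {ε : ℝ}

theorem isProbabilityMeasure_laplace_noise (hε : 0 < ε) (p : Fin K × ℕ) :
    IsProbabilityMeasure (laplace (2 / (ε * 2 ^ p.2))) :=
  isProbabilityMeasure_laplace (by positivity)

theorem isProbabilityMeasure_noiseLaw (K : ℕ) (hε : 0 < ε) :
    IsProbabilityMeasure (noiseLaw K ε) := by
  have := isProbabilityMeasure_laplace_noise (K := K) hε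
  rw [noiseLaw]
  infer_instance

theorem noiseLaw_real_le_shift (hε : 0 < ε) (p : Fin K × ℕ) {δ : ℝ} (hδ : |δ| ≤ 2 / 2 ^ p.2)
    {S : Set (Fin K × ℕ → ℝ)} (hS : MeasurableSet S) :
    (noiseLaw K ε).real S ≤ Real.exp ε * (noiseLaw K ε).real {Z | Z + Pi.single p δ ∈ S} := by
  have := isProbabilityMeasure_laplace_noise (K := K) hε
  have := isProbabilityMeasure_noiseLaw K hε
  let shift (q : Fin K × ℕ) (x : ℝ) : ℝ := x + (Pi.single p δ : Fin K × ℕ → ℝ) q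
  have hshift (q : Fin K × ℕ) : Measurable (shift q) := by fun_prop
  have (q : Fin K × ℕ) : IsProbabilityMeasure ((laplace (2 / (ε * 2 ^ q.2))).map (shift q)) :=
    Measure.isProbabilityMeasure_map (hshift q).aemeasurable
  have hfactor : |δ| / (2 / (ε * 2 ^ p.2)) ≤ ε := by
    rw [le_div_iff₀ (by positivity)] at hδ
    rw [div_div_eq_mul_div, div_le_iff₀ two_pos]
    nlinarith
  have hle : noiseLaw K ε ≤
      ENNReal.ofReal (Real.exp ε) • (noiseLaw K ε).map (fun Z => Z + Pi.single p δ) := by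
    have hmap : (noiseLaw K ε).map (fun Z => Z + Pi.single p δ) =
        Measure.infinitePi fun q => (laplace (2 / (ε * 2 ^ q.2))).map (shift q) :=
      Measure.infinitePi_map_pi _ hshift
    rw [hmap]
    refine infinitePi_le_smul_infinitePi (j := p) (fun q hq => ?_) ?_
    · simp only [shift, Pi.single_eq_of_ne hq, add_zero, Measure.map_id']
    · simpa only [shift, Pi.single_eq_same] using
        laplace_le_smul_map_add (δ := δ) (by positivity) hfactor
  have hS_le := hle S
  rw [Measure.smul_apply, smul_eq_mul, Measure.map_apply (by fun_prop) hS] at hS_le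
  refine (ENNReal.toReal_mono (by finiteness) hS_le).trans_eq ?_
  rw [ENNReal.toReal_mul, ENNReal.toReal_ofReal (Real.exp_pos ε).le]
  rfl

theorem noiseLaw_real_eval (hε : 0 < ε) (p : Fin K × ℕ) {S : Set ℝ} (hS : MeasurableSet S) :
    (noiseLaw K ε).real {Z | Z p ∈ S} = (laplace (2 / (ε * 2 ^ p.2))).real S := by
  have := isProbabilityMeasure_laplace_noise (K := K) hε
  exact (measurePreserving_eval_infinitePi
    (fun q : Fin K × ℕ => laplace (2 / (ε * 2 ^ q.2))) p).measureReal_preimage hS.nullMeasurableSet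

theorem noiseLaw_real_gt (hε : 0 < ε) (p : Fin K × ℕ) {s : ℝ} (hs : 0 ≤ s) :
    (noiseLaw K ε).real {Z | s < Z p} = Real.exp (-(s * (ε * 2 ^ p.2 / 2))) / 2 := by
  refine (noiseLaw_real_eval hε p measurableSet_Ioi).trans ?_
  rw [laplace_real_Ioi (by positivity) hs, div_div_eq_mul_div, mul_div_assoc, neg_mul]

theorem noiseLaw_real_lt (hε : 0 < ε) (p : Fin K × ℕ) {s : ℝ} (hs : 0 ≤ s) :
    (noiseLaw K ε).real {Z | Z p < -s} = Real.exp (-(s * (ε * 2 ^ p.2 / 2))) / 2 := by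
  refine (noiseLaw_real_eval hε p measurableSet_Iio).trans ?_
  rw [laplace_real_Iio (by positivity) hs, div_div_eq_mul_div, mul_div_assoc, neg_mul]

end NoiseLaw

/-! ### Independent Bernoulli rewards -/

theorem rewardValue_mem (b : Bool) : rewardValue b ∈ Set.Icc (0 : ℝ) 1 := by
  cases b <;> simp [rewardValue]

section RewardSum

variable {ι : Type*}

theorem sum_rewardValue_mem (ω : ι → Bool) (s : Finset ι) :
    ∑ i ∈ s, rewardValue (ω i) ∈ Set.Icc (0 : ℝ) s.card := by
  refine ⟨Finset.sum_nonneg fun i _ => (rewardValue_mem _).1, ?_⟩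
  simpa using Finset.sum_le_card_nsmul s (fun i => rewardValue (ω i)) 1
    fun i _ => (rewardValue_mem _).2

theorem measurable_rewardValue_apply (i : ι) :
    Measurable fun ω : ι → Bool => rewardValue (ω i) :=
  (measurable_of_finite rewardValue).comp (measurable_pi_apply i)

/-- The law of independent Bernoulli rewards `ω i` of means `μ i`. -/
def bernoulliPi (μ : ι → unitInterval) : Measure (ι → Bool) :=
  Measure.infinitePi fun i => bernoulliMeasure true false (μ i)

variable {μ : ι → unitInterval} {s : Finset ι} {p : unitInterval}

instance isProbabilityMeasure_bernoulliPi (μ : ι → unitInterval) :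
    IsProbabilityMeasure (bernoulliPi μ) := by
  rw [bernoulliPi]
  infer_instance

theorem bernoulliMeasure_real_singleton (p : unitInterval) (b : Bool) :
    (bernoulliMeasure true false p).real {b} = bernoulliMass p b := by
  cases b <;> simp [bernoulliMass]

theorem bernoulliPi_real_forall_eq (μ : ι → unitInterval) (s : Finset ι) (b : ι → Bool) :
    (bernoulliPi μ).real {ω | ∀ i ∈ s, ω i = b i} = ∏ i ∈ s, bernoulliMass (μ i) (b i) := by
  have hpi : {ω : ι → Bool | ∀ i ∈ s, ω i = b i} = (s : Set ι).pi fun i => {b i} := by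
    ext ω
    simp
  rw [hpi, measureReal_def, bernoulliPi,
    Measure.infinitePi_pi _ (fun i _ => measurableSet_singleton _), ENNReal.toReal_prod]
  exact Finset.prod_congr rfl fun i _ => bernoulliMeasure_real_singleton _ _

theorem mgf_rewardValue (μ : ι → unitInterval) (i : ι) (t : ℝ) :
    mgf (fun ω => rewardValue (ω i)) (bernoulliPi μ) t = 1 - μ i + μ i * Real.exp t := by
  have hmap := (measurePreserving_eval_infinitePi
    (fun i => bernoulliMeasure true false (μ i)) i).map_eq
  have hintegral := integral_map (μ := bernoulliPi μ) (φ := fun ω => ω i)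
    (measurable_pi_apply i).aemeasurable (f := fun b : Bool => Real.exp (t * rewardValue b))
    (measurable_of_finite _).aestronglyMeasurable
  rw [mgf, ← hintegral, bernoulliPi, hmap, integral_bernoulliMeasure]
  simp [rewardValue]
  ring

theorem mgf_sum_rewardValue (hs : ∀ i ∈ s, μ i = p) (t : ℝ) :
    mgf (fun ω => ∑ i ∈ s, rewardValue (ω i)) (bernoulliPi μ) t =
      (1 - p + p * Real.exp t) ^ s.card := by
  have hindep : iIndepFun (fun i (ω : ι → Bool) => rewardValue (ω i)) (bernoulliPi μ) :=
    iIndepFun_infinitePi (P := fun i => bernoulliMeasure true false (μ i))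
      (X := fun _ b => rewardValue b) fun _ => measurable_of_finite _
  have hsum := hindep.mgf_sum (t := t) measurable_rewardValue_apply s
  rw [Finset.sum_fn] at hsum
  rw [hsum]
  exact Finset.prod_eq_pow_card fun i hi => by rw [mgf_rewardValue, hs i hi]

theorem integrable_exp_sum_rewardValue (μ : ι → unitInterval) (s : Finset ι) (t : ℝ) :
    Integrable (fun ω => Real.exp (t * ∑ i ∈ s, rewardValue (ω i))) (bernoulliPi μ) :=
  integrable_exp_mul_of_mem_Icc
    (Finset.measurable_sum s fun i _ => measurable_rewardValue_apply i).aemeasurable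
    (Filter.Eventually.of_forall fun ω => sum_rewardValue_mem ω s)

/-- The value of the Chernoff bound at its optimal parameter. -/
theorem exp_mul_pow_eq_exp_klReal {m q : ℝ} (hm : 0 < m) (hm1 : m < 1) (hq : 0 < q) (hq1 : q < 1)
    (n : ℕ) :
    Real.exp (-Real.log (m * (1 - q) / (q * (1 - m))) * (n * m)) *
      (1 - q + q * Real.exp (Real.log (m * (1 - q) / (q * (1 - m))))) ^ n =
      Real.exp (-(n * klReal m q)) := by
  have hq1' : 0 < 1 - q := by linarith
  have hm1' : 0 < 1 - m := by linarith
  have hbase : 1 - q + q * (m * (1 - q) / (q * (1 - m))) =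
      Real.exp (Real.log ((1 - q) / (1 - m))) := by
    rw [Real.exp_log (by positivity)]
    field_simp
    ring
  rw [Real.exp_log (by positivity), hbase, ← Real.exp_nat_mul, ← Real.exp_add, klReal,
    Real.log_div (by positivity) (by positivity), Real.log_mul hm.ne' hq1'.ne',
    Real.log_mul hq.ne' hm1'.ne', Real.log_div hq1'.ne' hm1'.ne', Real.log_div hm.ne' hq.ne',
    Real.log_div hm1'.ne' hq1'.ne']
  congr 1
  ring

theorem bernoulliPi_real_sum_le_of_pos {m : ℝ} (hs : ∀ i ∈ s, μ i = p) (hm : 0 < m)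
    (hmp : m ≤ p) (hp1 : (p : ℝ) < 1) :
    (bernoulliPi μ).real {ω | ∑ i ∈ s, rewardValue (ω i) ≤ s.card * m} ≤
      Real.exp (-(s.card * klReal m p)) := by
  have hp0 : (0 : ℝ) < p := hm.trans_le hmp
  have hlog : Real.log (m * (1 - p) / (p * (1 - m))) ≤ 0 := by
    refine Real.log_nonpos ?_ ?_
    · exact div_nonneg (mul_nonneg hm.le (by linarith)) (mul_nonneg hp0.le (by linarith))
    · rw [div_le_one (mul_pos hp0 (by linarith))]
      linarith
  refine (measure_le_le_exp_mul_mgf (s.card * m) hlog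
    (integrable_exp_sum_rewardValue μ s _)).trans_eq ?_
  rw [mgf_sum_rewardValue hs, exp_mul_pow_eq_exp_klReal hm (hmp.trans_lt hp1) hp0 hp1]

theorem bernoulliPi_real_sum_le {m : ℝ} (hs : ∀ i ∈ s, μ i = p) (hm : 0 ≤ m) (hmp : m ≤ p)
    (hp0 : (0 : ℝ) < p) (hp1 : (p : ℝ) < 1) :
    (bernoulliPi μ).real {ω | ∑ i ∈ s, rewardValue (ω i) ≤ s.card * m} ≤
      Real.exp (-(s.card * klReal m p)) := by
  rcases hm.eq_or_lt with rfl | hm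
  · have hcont : Continuous fun x => Real.exp (-(s.card * klReal x p)) := by
      have := continuous_klReal_left hp0.ne' hp1.ne
      fun_prop
    refine ge_of_tendsto (hcont.tendsto 0 |>.mono_left (nhdsWithin_le_nhds (s := Set.Ioi 0))) ?_
    filter_upwards [Ioo_mem_nhdsGT hp0] with x hx
    refine (measureReal_mono fun ω hω => ?_).trans
      (bernoulliPi_real_sum_le_of_pos hs hx.1 hx.2.le hp1)
    exact le_trans hω (mul_le_mul_of_nonneg_left hx.1.le s.card.cast_nonneg)
  · exact bernoulliPi_real_sum_le_of_pos hs hm hmp hp1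

/-- For `p = 0`, where the relative entropy is infinite, the exponential moment of order `1 / 4` is
enough. -/
theorem bernoulliPi_real_le_sum {r : ℝ} (hs : ∀ i ∈ s, μ i = p) (hpr : p < r) (hr : r < 1) :
    (bernoulliPi μ).real {ω | s.card * r ≤ ∑ i ∈ s, rewardValue (ω i)} ≤
      Real.exp (-(s.card * ((r - p) ^ 2 / (4 * (r * (1 - p)))))) := by
  have chernoff {t : ℝ} (ht : 0 ≤ t) := measure_ge_le_exp_mul_mgf (s.card * r) ht
    (integrable_exp_sum_rewardValue μ s t)
  simp only [mgf_sum_rewardValue hs] at chernoff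
  have hr0 : 0 < r := p.2.1.trans_lt hpr
  rcases p.2.1.eq_or_lt with hp | hp
  · refine (chernoff (t := 1 / 4) (by norm_num)).trans_eq ?_
    rw [← hp, sub_zero, zero_mul, add_zero, one_pow, mul_one]
    congr 1
    field_simp
    ring
  · have hlog : 0 ≤ Real.log (r * (1 - p) / (p * (1 - r))) := by
      refine Real.log_nonneg ?_
      rw [one_le_div (mul_pos hp (by linarith))]
      linarith
    refine (chernoff hlog).trans ?_
    rw [exp_mul_pow_eq_exp_klReal hr0 hr hp (hpr.trans hr)]
    have := sq_div_le_klReal hp hpr.le hr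
    gcongr

theorem bernoulliPi_real_mean_lt_one (hs : ∀ i ∈ s, μ i = 1) (hs0 : s.Nonempty) :
    (bernoulliPi μ).real {ω | (∑ i ∈ s, rewardValue (ω i)) / s.card < 1} = 0 := by
  have hall : (bernoulliPi μ).real {ω | ∀ i ∈ s, ω i = true} = 1 := by
    rw [bernoulliPi_real_forall_eq μ s fun _ => true]
    exact Finset.prod_eq_one fun i hi => by simp [hs i hi, bernoulliMass]
  have hmeas : MeasurableSet {ω : ι → Bool | ∀ i ∈ s, ω i = true} := by
    simp only [Set.ofPred_forall]
    exact s.measurableSet_biInter fun i _ =>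
      measurableSet_eq_fun (measurable_pi_apply i) measurable_const
  refine le_antisymm ?_ measureReal_nonneg
  calc _ ≤ (bernoulliPi μ).real {ω | ∀ i ∈ s, ω i = true}ᶜ := by
        refine measureReal_mono fun ω hω hone => ?_
        have hcard : (s.card : ℝ) ≠ 0 := by exact_mod_cast hs0.card_ne_zero
        have hsum : ∑ i ∈ s, rewardValue (ω i) = s.card := by
          rw [Finset.sum_congr rfl fun i hi => by rw [hone i hi]]
          simp [rewardValue]
        rw [Set.mem_ofPred_eq, hsum, div_self hcard] at hω
        exact lt_irrefl _ hω
    _ = 0 := by rw [probReal_compl_eq_one_sub hmeas, hall, sub_self]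

/-- The largest mean at which the relative entropy is still at least `b` reduces the event to a
single lower tail. -/
theorem bernoulliPi_real_klBer_gt (hs : ∀ i ∈ s, μ i = p) (hs0 : s.Nonempty) (b : ℝ) :
    (bernoulliPi μ).real {ω | (∑ i ∈ s, rewardValue (ω i)) / s.card < p ∧
      (b : EReal) < klBer ((∑ i ∈ s, rewardValue (ω i)) / s.card) p} ≤
      Real.exp (-(s.card * b)) := by
  have hcard : (0 : ℝ) < s.card := by exact_mod_cast hs0.card_pos
  set A := {ω : ι → Bool | (∑ i ∈ s, rewardValue (ω i)) / s.card < p ∧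
      (b : EReal) < klBer ((∑ i ∈ s, rewardValue (ω i)) / s.card) p}
  rcases A.eq_empty_or_nonempty with hA | ⟨ω₀, hω₀⟩
  · rw [hA, measureReal_empty]
    exact (Real.exp_pos _).le
  have hmean (ω : ι → Bool) : 0 ≤ (∑ i ∈ s, rewardValue (ω i)) / s.card :=
    div_nonneg (sum_rewardValue_mem ω s).1 hcard.le
  have hp0 : (0 : ℝ) < p := (hmean ω₀).trans_lt hω₀.1
  rcases p.2.2.eq_or_lt with hp | hp1
  · refine (measureReal_mono fun ω hω => ?_).trans
      ((bernoulliPi_real_mean_lt_one (fun i hi => (hs i hi).trans (Subtype.ext hp)) hs0).trans_le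
        (Real.exp_pos _).le)
    exact hω.1.trans_eq hp
  let D : Set ℝ := Set.Icc 0 (p : ℝ) ∩ {x | b ≤ klReal x p}
  have hD : ∀ ω ∈ A, (∑ i ∈ s, rewardValue (ω i)) / s.card ∈ D := fun ω hω =>
    ⟨⟨hmean ω, hω.1.le⟩, by simpa [klBer_eq_klReal _ hp0.ne' hp1.ne] using hω.2.le⟩
  have hD_compact : IsCompact D := isCompact_Icc.inter_right
    (isClosed_le continuous_const (continuous_klReal_left hp0.ne' hp1.ne))
  obtain ⟨m, ⟨⟨hm0, hmp⟩, hbm⟩, hm_max⟩ := hD_compact.exists_isGreatest ⟨_, hD ω₀ hω₀⟩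
  calc (bernoulliPi μ).real A
      ≤ (bernoulliPi μ).real {ω | ∑ i ∈ s, rewardValue (ω i) ≤ s.card * m} :=
        measureReal_mono fun ω hω => (div_le_iff₀' hcard).1 (hm_max (hD ω hω))
    _ ≤ Real.exp (-(s.card * klReal m p)) := bernoulliPi_real_sum_le hs hm0 hmp hp0 hp1
    _ ≤ Real.exp (-(s.card * b)) := by
        have : b ≤ klReal m p := hbm
        gcongr

end RewardSum

/-! ### The memory along a sequence of actions -/

section Run

variable {K T : ℕ} {ε α : ℝ} {sel : (Fin K → ℝ) → Fin K} {Z : Fin K × ℕ → ℝ} {r r' : ℕ → ℝ}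
  {a a' : ℕ → Fin K}

/-- The memory after `t` rounds in which the arms `a 0, …, a (t - 1)` were played, whether or not
the algorithm would have played them. It separates the bookkeeping, which does not see the noise,
from the choice of the arms. -/
def stateAlong (a : ℕ → Fin K) (r : ℕ → ℝ) : ℕ → State K
  | 0 => initialState K
  | t + 1 => updateState (stateAlong a r t) (a t) (r t)

theorem runState_eq_stateAlong {t : ℕ} (h : ∀ s < t, runAction ε α sel Z r s = a s) :
    runState ε α sel Z r t = stateAlong a r t := by
  induction t with
  | zero => rfl
  | succ t ih =>
    have hstep : chooseArm ε α sel Z (runState ε α sel Z r t) t = a t := h t (by omega)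
    rw [runState, stateAlong, hstep, ih fun s hs => h s (by omega)]

theorem forall_runAction_iff :
    (∀ t < T, runAction ε α sel Z r t = a t) ↔
      ∀ t < T, chooseArm ε α sel Z (stateAlong a r t) t = a t := by
  constructor
  · intro h t ht
    rw [← runState_eq_stateAlong fun s hs => h s (by omega)]
    exact h t ht
  · intro h t
    induction t using Nat.strong_induction_on with
    | _ t ih =>
      intro ht
      rw [runAction, runState_eq_stateAlong fun s hs => ih s hs (by omega)]
      exact h t ht

theorem runState_congr {t : ℕ} (hr : ∀ s < t, r s = r' s) :
    runState ε α sel Z r t = runState ε α sel Z r' t := by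
  induction t with
  | zero => rfl
  | succ t ih =>
    rw [runState, runState, ih fun s hs => hr s (by omega), hr t (by omega)]

section Update

variable (s : State K) {b c : Fin K} (x : ℝ)

theorem updateState_pulls_self : (updateState s b x).pulls b = s.pulls b + 1 :=
  Function.update_self ..

theorem updateState_pulls_of_ne (h : c ≠ b) : (updateState s b x).pulls c = s.pulls c :=
  Function.update_of_ne h ..

theorem updateState_start (b : Fin K) :
    (updateState s b x).start =
      if s.current = none then Function.update s.start b (s.pulls b) else s.start := rfl

theorem updateState_start_self :
    (updateState s b x).start b = if s.current = none then s.pulls b else s.start b := by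
  rw [updateState_start]
  split_ifs
  · exact Function.update_self ..
  · rfl

theorem updateState_start_of_ne (h : c ≠ b) : (updateState s b x).start c = s.start c := by
  rw [updateState_start]
  split_ifs
  · exact Function.update_of_ne h ..
  · rfl

theorem updateState_sum_self :
    (updateState s b x).sum b = if s.current = none then x else s.sum b + x := by
  simp only [updateState, Function.update_self]
  split_ifs
  · rw [Function.update_self, zero_add]
  · rfl

theorem updateState_sum_of_ne (h : c ≠ b) : (updateState s b x).sum c = s.sum c := by
  simp only [updateState, Function.update_of_ne h]
  split_ifs
  · exact Function.update_of_ne h ..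
  · rfl

theorem updateState_current (b : Fin K) :
    (updateState s b x).current =
      if s.pulls b + 1 < 2 * (updateState s b x).start b then some b else none := rfl

end Update

theorem pulls_eq_card (a : ℕ → Fin K) (r : ℕ → ℝ) (t : ℕ) (c : Fin K) :
    (stateAlong a r t).pulls c = ((Finset.range t).filter fun s => a s = c).card := by
  induction t with
  | zero => rfl
  | succ t ih =>
    rw [stateAlong, Finset.range_add_one, Finset.filter_insert]
    rcases eq_or_ne c (a t) with rfl | h
    · rw [updateState_pulls_self, if_pos rfl, Finset.card_insert_of_notMem (by simp), ih]
    · rw [updateState_pulls_of_ne _ _ h, if_neg (Ne.symm h), ih]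

theorem pulls_congr (a : ℕ → Fin K) (r r' : ℕ → ℝ) (t : ℕ) :
    (stateAlong a r t).pulls = (stateAlong a r' t).pulls := by
  ext c
  rw [pulls_eq_card, pulls_eq_card]

theorem sum_pulls (a : ℕ → Fin K) (r : ℕ → ℝ) (t : ℕ) :
    ∑ c, (stateAlong a r t).pulls c = t := by
  simp only [pulls_eq_card]
  rw [← Finset.card_eq_sum_card_fiberwise fun s _ => Finset.mem_coe.2 (Finset.mem_univ (a s)),
    Finset.card_range]

/-- The entry that is read in round `t` from a table of rewards whose entry `(c, i)` is the reward
of the `(i + 1)`-th play of arm `c`. -/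
def slot (a : ℕ → Fin K) (t : ℕ) : Fin K × ℕ :=
  (a t, ((Finset.range t).filter fun s => a s = a t).card)

theorem slot_eq (a : ℕ → Fin K) (r : ℕ → ℝ) (t : ℕ) :
    slot a t = (a t, (stateAlong a r t).pulls (a t)) := by
  rw [slot, pulls_eq_card]

theorem slot_congr {t : ℕ} (h : ∀ s ≤ t, a s = a' s) : slot a t = slot a' t := by
  rw [slot, slot, h t le_rfl]
  congr 2
  exact Finset.filter_congr fun s hs => by rw [h s (Finset.mem_range.1 hs).le]

theorem monotone_pulls (a : ℕ → Fin K) (r : ℕ → ℝ) (c : Fin K) :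
    Monotone fun t => (stateAlong a r t).pulls c := fun s t hst => by
  simp only [pulls_eq_card]
  gcongr

theorem injective_slot (a : ℕ → Fin K) : Function.Injective (slot a) := by
  refine Function.Injective.of_lt_imp_ne fun s t hst heq => ?_
  obtain ⟨harm, hcount⟩ := Prod.mk.inj heq
  rw [← harm] at hcount
  refine hcount.not_lt (Finset.card_lt_card ⟨?_, fun hsub => ?_⟩)
  · gcongr
  · simpa using hsub (Finset.mem_filter.2 ⟨Finset.mem_range.2 hst, rfl⟩)

theorem start_current_congr (a : ℕ → Fin K) (r r' : ℕ → ℝ) (t : ℕ) :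
    (stateAlong a r t).start = (stateAlong a r' t).start ∧
      (stateAlong a r t).current = (stateAlong a r' t).current := by
  induction t with
  | zero => exact ⟨rfl, rfl⟩
  | succ t ih =>
    have hstart : (stateAlong a r (t + 1)).start = (stateAlong a r' (t + 1)).start := by
      rw [stateAlong, stateAlong, updateState_start, updateState_start, ih.1, ih.2,
        pulls_congr a r r' t]
    refine ⟨hstart, ?_⟩
    rw [stateAlong, stateAlong] at hstart ⊢
    rw [updateState_current, updateState_current, hstart, pulls_congr a r r' t]

/-- The doubling scheme: outside a running episode an arm was played `2 ^ j` times, half of them in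
its last episode (`2 ^ j / 2` is the natural division, so that `j = 0` is the initial play); during
an episode that was opened after `2 ^ j` plays, their number is less than `2 ^ (j + 1)`. -/
structure DoublingInvariant (s : State K) : Prop where
  idle : ∀ c, s.current ≠ some c →
    (s.pulls c = 0 ∧ s.start c = 0) ∨ ∃ j, s.pulls c = 2 ^ j ∧ s.start c = 2 ^ j / 2
  busy : ∀ c, s.current = some c → ∃ j, s.start c = 2 ^ j ∧ 2 ^ j < s.pulls c ∧
    s.pulls c < 2 ^ (j + 1)

namespace DoublingInvariant

variable {s : State K} {b : Fin K}

theorem start_le_pulls (h : DoublingInvariant s) (c : Fin K) : s.start c ≤ s.pulls c := by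
  by_cases hc : s.current = some c
  · obtain ⟨j, hstart, hlt, -⟩ := h.busy c hc
    omega
  · rcases h.idle c hc with h | ⟨j, hpulls, hstart⟩ <;> omega

theorem updateState_start_self_cases (h : DoublingInvariant s)
    (hb : s.current = none ∨ s.current = some b) (x : ℝ) :
    ((updateState s b x).start b = 0 ∧ s.pulls b = 0) ∨
      ∃ j, (updateState s b x).start b = 2 ^ j ∧ 2 ^ j ≤ s.pulls b ∧ s.pulls b < 2 ^ (j + 1) := by
  rw [updateState_start_self]
  rcases hb with hb | hb
  · rw [if_pos hb]
    rcases h.idle b (by simp [hb]) with ⟨hpulls, -⟩ | ⟨j, hpulls, -⟩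
    · exact Or.inl ⟨hpulls, hpulls⟩
    · exact Or.inr ⟨j, hpulls, hpulls.ge, hpulls.trans_lt (Nat.pow_lt_pow_succ one_lt_two)⟩
  · rw [if_neg (by simp [hb])]
    obtain ⟨j, hstart, hlt, hlt'⟩ := h.busy b hb
    exact Or.inr ⟨j, hstart, hlt.le, hlt'⟩

theorem updateState (h : DoublingInvariant s) (hb : s.current = none ∨ s.current = some b)
    (x : ℝ) : DoublingInvariant (updateState s b x) := by
  have hstart := h.updateState_start_self_cases hb x
  have hcurrent := updateState_current s x b
  constructor
  · intro c hc
    rcases eq_or_ne c b with rfl | hcb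
    · have hdone : ¬ s.pulls c + 1 < 2 * (PrivateBandit.updateState s c x).start c :=
        fun hlt => hc (by rw [hcurrent, if_pos hlt])
      rw [updateState_pulls_self]
      rcases hstart with ⟨h0, hpulls⟩ | ⟨j, hj, -, hlt⟩
      · exact Or.inr ⟨0, by simp [hpulls], by simp [h0]⟩
      · refine Or.inr ⟨j + 1, ?_, ?_⟩ <;> rw [pow_succ] at * <;> omega
    · rw [updateState_pulls_of_ne _ _ hcb, updateState_start_of_ne _ _ hcb]
      refine h.idle c fun hcur => ?_
      rcases hb with hb | hb
      · simp [hb] at hcur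
      · exact hcb (Option.some_inj.1 (hcur.symm.trans hb))
  · intro c hc
    rw [hcurrent] at hc
    split_ifs at hc with hlt
    obtain rfl : b = c := Option.some_inj.1 hc
    rw [updateState_pulls_self]
    rcases hstart with ⟨h0, -⟩ | ⟨j, hj, hle, -⟩
    · omega
    · exact ⟨j, hj, by omega, by rw [pow_succ]; omega⟩

end DoublingInvariant

/-- The first `T` actions of `a` respect the initial phase and the running episodes; only the
choices at the openings of episodes remain free. -/
def Admissible (a : ℕ → Fin K) (r : ℕ → ℝ) (T : ℕ) : Prop :=
  ∀ t < T, (∀ h : t < K, a t = ⟨t, h⟩) ∧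
    (K ≤ t → ∀ b, (stateAlong a r t).current = some b → a t = b)

namespace Admissible

theorem of_chooseArm (h : ∀ t < T, chooseArm ε α sel Z (stateAlong a r t) t = a t) :
    Admissible a r T := by
  intro t ht
  constructor
  · intro hK
    rw [← h t ht, chooseArm, dif_pos hK]
  · intro hK b hb
    rw [← h t ht, chooseArm, dif_neg (by omega), hb]

theorem initial (h : Admissible a r T) {t : ℕ} (ht : t ≤ T) (htK : t ≤ K) :
    (stateAlong a r t).current = none ∧
      ∀ c, (stateAlong a r t).pulls c = (if (c : ℕ) < t then 1 else 0) ∧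
        (stateAlong a r t).start c = 0 := by
  induction t with
  | zero => simp [stateAlong, initialState]
  | succ t ih =>
    obtain ⟨hnone, hcounts⟩ := ih (by omega) (by omega)
    have hval : ((a t : Fin K) : ℕ) = t := by rw [(h t (by omega)).1 (by omega)]
    have hfresh : (stateAlong a r t).pulls (a t) = 0 := by
      rw [(hcounts (a t)).1, if_neg (by omega)]
    have hstart : ∀ c, (updateState (stateAlong a r t) (a t) (r t)).start c = 0 := by
      intro c
      rcases eq_or_ne c (a t) with rfl | hc
      · rw [updateState_start_self, if_pos hnone, hfresh]
      · rw [updateState_start_of_ne _ _ hc, (hcounts c).2]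
    rw [stateAlong]
    refine ⟨by rw [updateState_current, hstart, if_neg (by omega)], fun c => ⟨?_, hstart c⟩⟩
    rcases eq_or_ne c (a t) with rfl | hc
    · rw [updateState_pulls_self, hfresh, if_pos (by omega)]
    · have hne : (c : ℕ) ≠ t := fun hct => hc (Fin.ext (hct.trans hval.symm))
      rw [updateState_pulls_of_ne _ _ hc, (hcounts c).1]
      simp only [Nat.lt_succ_iff_lt_or_eq, hne, or_false]

theorem current_eq (h : Admissible a r T) {t : ℕ} (ht : t < T) :
    (stateAlong a r t).current = none ∨ (stateAlong a r t).current = some (a t) := by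
  rcases lt_or_ge t K with hK | hK
  · exact Or.inl (h.initial ht.le hK.le).1
  · rcases hc : (stateAlong a r t).current with _ | b
    · exact Or.inl rfl
    · exact Or.inr (congrArg some ((h t ht).2 hK b hc).symm)

theorem doublingInvariant (h : Admissible a r T) {t : ℕ} (ht : t ≤ T) :
    DoublingInvariant (stateAlong a r t) := by
  induction t with
  | zero => exact ⟨fun _ _ => Or.inl ⟨rfl, rfl⟩, nofun⟩
  | succ t ih => exact (ih (by omega)).updateState (h.current_eq (by omega)) _

theorem pulls_pos (h : Admissible a r T) {t : ℕ} (ht : t ≤ T) (hK : K ≤ t) (c : Fin K) :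
    0 < (stateAlong a r t).pulls c := calc
  0 < (stateAlong a r K).pulls c := by
    rw [((h.initial (hK.trans ht) le_rfl).2 c).1, if_pos c.2]
    exact one_pos
  _ ≤ _ := monotone_pulls a r c hK

theorem pulls_eq_two_pow (h : Admissible a r T) {t : ℕ} (ht : t ≤ T) (hK : K ≤ t)
    (hc : (stateAlong a r t).current = none) (c : Fin K) :
    ∃ j, (stateAlong a r t).pulls c = 2 ^ j ∧ (stateAlong a r t).start c = 2 ^ j / 2 :=
  ((h.doublingInvariant ht).idle c (by simp [hc])).resolve_left
    fun h0 => (h.pulls_pos ht hK c).ne' h0.1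

theorem sum_eq (h : Admissible a r T) {Y : Fin K × ℕ → ℝ}
    (hY : ∀ t < T, r t = Y (slot a t)) {t : ℕ} (ht : t ≤ T)
    (c : Fin K) :
    (stateAlong a r t).sum c =
      ∑ i ∈ Finset.Ico ((stateAlong a r t).start c) ((stateAlong a r t).pulls c), Y (c, i) := by
  induction t generalizing c with
  | zero => rfl
  | succ t ih =>
    have hle := (h.doublingInvariant (t := t) (by omega)).start_le_pulls c
    rw [stateAlong]
    rcases eq_or_ne c (a t) with rfl | hc
    · rw [updateState_sum_self, updateState_start_self, updateState_pulls_self]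
      split_ifs
      · rw [Nat.Ico_succ_singleton, Finset.sum_singleton, hY t (by omega), slot_eq a r]
      · rw [Finset.sum_Ico_succ_top hle, ih (by omega), hY t (by omega), slot_eq a r]
    · rw [updateState_sum_of_ne _ _ hc, updateState_start_of_ne _ _ hc,
        updateState_pulls_of_ne _ _ hc, ih (by omega)]

end Admissible

end Run

/-! ### Privacy -/

section Privacy

variable {K T : ℕ} {ε α : ℝ} {sel : (Fin K → ℝ) → Fin K} {r r' : ℕ → ℝ} {a : ℕ → Fin K} {j : ℕ}

theorem measurable_chooseArm (hsel : Measurable sel) (s : State K) (t : ℕ) :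
    Measurable fun Z : Fin K × ℕ → ℝ => chooseArm ε α sel Z s t := by
  by_cases hK : t < K
  · simp only [chooseArm, dif_pos hK, measurable_const]
  · rcases hc : s.current with _ | b
    · simp only [chooseArm, dif_neg hK, hc]
      refine hsel.comp (measurable_pi_lambda _ fun c => ?_)
      refine (monotone_klIndex ε α _ _).measurable.comp ?_
      unfold privateMean
      fun_prop
    · simp only [chooseArm, dif_neg hK, hc, measurable_const]

/-- The noise for which the arms `a 0, …, a (T - 1)` are played. -/
def actionEvent (ε α : ℝ) (sel : (Fin K → ℝ) → Fin K) (a : ℕ → Fin K) (r : ℕ → ℝ) (T : ℕ) :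
    Set (Fin K × ℕ → ℝ) := {Z | ∀ t < T, runAction ε α sel Z r t = a t}

theorem mem_actionEvent_iff {Z : Fin K × ℕ → ℝ} :
    Z ∈ actionEvent ε α sel a r T ↔ ∀ t < T, chooseArm ε α sel Z (stateAlong a r t) t = a t :=
  forall_runAction_iff

theorem measurableSet_actionEvent (hsel : Measurable sel) (a : ℕ → Fin K) (r : ℕ → ℝ) (T : ℕ) :
    MeasurableSet (actionEvent ε α sel a r T) := by
  have hinter : actionEvent ε α sel a r T =
      ⋂ t, ⋂ _ : t < T, {Z | chooseArm ε α sel Z (stateAlong a r t) t = a t} := by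
    ext Z
    simp only [mem_actionEvent_iff, Set.mem_ofPred_eq, Set.mem_iInter]
  rw [hinter]
  exact MeasurableSet.iInter fun t => MeasurableSet.iInter fun _ =>
    measurable_chooseArm hsel _ _ (measurableSet_singleton (a t))

/-- Extension of a finite sequence by a default value. The policies of the statement are fed finite
sequences, the recursion of the algorithm runs over infinite ones. -/
def extendFin {β : Type*} {T : ℕ} (d : β) (f : Fin T → β) (n : ℕ) : β :=
  if h : n < T then f ⟨n, h⟩ else d

theorem extendFin_of_lt {β : Type*} (d : β) (f : Fin T → β) {n : ℕ} (h : n < T) :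
    extendFin d f n = f ⟨n, h⟩ := dif_pos h

theorem extendFin_apply {β : Type*} (d : β) (f : Fin T → β) (t : Fin T) :
    extendFin d f t = f t := extendFin_of_lt d f t.2

theorem adaPKLUCB_eq (d : Fin K) (a : Fin T → Fin K) (r : Fin T → ℝ) :
    adaPKLUCB K ε α sel T a r =
      (noiseLaw K ε).real (actionEvent ε α sel (extendFin d a) (extendFin 0 r) T) := by
  rw [adaPKLUCB]
  congr 1
  ext Z
  refine Fin.forall_iff.trans (forall₂_congr fun t ht => ?_)
  rw [extendFin_of_lt _ _ ht]
  rfl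

theorem Admissible.congr_rewards (h : Admissible a r T) (r' : ℕ → ℝ) : Admissible a r' T := by
  intro t ht
  rw [← (start_current_congr a r r' t).2]
  exact h t ht

theorem Admissible.sum_of_neighbouring (h : Admissible a r T) (hr : ∀ t, t ≠ j → r t = r' t)
    {t : ℕ} (ht : t ≤ T) (c : Fin K) :
    (stateAlong a r' t).sum c = (stateAlong a r t).sum c +
      if c = (slot a j).1 ∧
        (slot a j).2 ∈ Finset.Ico ((stateAlong a r t).start c) ((stateAlong a r t).pulls c)
      then r' j - r j else 0 := by
  set Y : Fin K × ℕ → ℝ := Function.extend (slot a) r 0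
  have hYr : ∀ t, r t = Y (slot a t) := fun t => ((injective_slot a).extend_apply r 0 t).symm
  have hYr' : ∀ t, r' t = Function.update Y (slot a j) (r' j) (slot a t) := by
    intro t
    rcases eq_or_ne t j with rfl | htj
    · rw [Function.update_self]
    · rw [Function.update_of_ne ((injective_slot a).ne htj), ← hYr, hr t htj]
  have hupdate : ∀ i, Function.update Y (slot a j) (r' j) (c, i) =
      Y (c, i) + if c = (slot a j).1 ∧ (slot a j).2 = i then r' j - r j else 0 := by
    intro i
    simp only [Function.update_apply, Prod.ext_iff, eq_comm (a := i)]
    split_ifs with hi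
    · rw [hi.1, ← hi.2, hYr j]
      ring
    · rw [add_zero]
  rw [(h.congr_rewards r').sum_eq (fun t _ => hYr' t) ht, h.sum_eq (fun t _ => hYr t) ht,
    ← (start_current_congr a r r' t).1, pulls_congr a r' r]
  simp only [hupdate, Finset.sum_add_distrib, ite_and, Finset.sum_ite_irrel, Finset.sum_ite_eq,
    Finset.sum_const_zero]

/-- The plays of an arm in its episode that ends after `2 ^ k` plays; natural division makes
`k = 0` the initial play. -/
def episode (k : ℕ) : Finset ℕ := Finset.Ico (2 ^ k / 2) (2 ^ k)

theorem mem_Ico_two_pow_half_iff {i k : ℕ} :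
    i ∈ Finset.Ico (2 ^ k / 2) (2 ^ k) ↔ k = Nat.size i := by
  rw [Finset.mem_Ico]
  rcases k with _ | k
  · simp [eq_comm, Nat.size_eq_zero]
  · rw [pow_succ, Nat.mul_div_cancel _ two_pos, ← pow_succ, ← Nat.lt_size, ← Nat.size_le]
    omega

theorem card_episode (k : ℕ) :
    ((episode k).card : ℝ) = ((2 ^ k : ℕ) : ℝ) - ((2 ^ k / 2 : ℕ) : ℝ) := by
  rw [episode, Nat.card_Ico, Nat.cast_sub (Nat.div_le_self _ _)]

theorem half_two_pow_le_card_episode (k : ℕ) : (2 : ℝ) ^ k / 2 ≤ (episode k).card := by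
  have hdiv : ((2 ^ k / 2 : ℕ) : ℝ) ≤ ((2 ^ k : ℕ) : ℝ) / 2 := Nat.cast_div_le
  rw [card_episode]
  push_cast at hdiv ⊢
  linarith

theorem card_episode_pos (k : ℕ) : (0 : ℝ) < (episode k).card :=
  lt_of_lt_of_le (by positivity) (half_two_pow_le_card_episode k)

theorem privateMean_eq_div_card_episode_add {s : State K} {c : Fin K} {k : ℕ}
    (hpulls : s.pulls c = 2 ^ k) (hstart : s.start c = 2 ^ k / 2) (Z : Fin K × ℕ → ℝ) :
    privateMean Z s c = s.sum c / (episode k).card + Z (c, k) := by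
  rw [privateMean, hpulls, hstart, Nat.log_pow one_lt_two, card_episode]

/-- The shift of the noise that makes up for replacing the reward of round `j`: it acts on the noise
of the episode that contains round `j`. -/
def noiseShift (a : ℕ → Fin K) (r r' : ℕ → ℝ) (j : ℕ) : Fin K × ℕ → ℝ :=
  let k := Nat.size (slot a j).2
  Pi.single ((slot a j).1, k) ((r' j - r j) / (episode k).card)

theorem Admissible.privateMean_of_neighbouring (h : Admissible a r T)
    (hr : ∀ t, t ≠ j → r t = r' t) (Z : Fin K × ℕ → ℝ) {t : ℕ} (ht : t ≤ T) (hK : K ≤ t)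
    (hnone : (stateAlong a r t).current = none) (c : Fin K) :
    privateMean Z (stateAlong a r' t) c =
      privateMean (Z + noiseShift a r r' j) (stateAlong a r t) c := by
  obtain ⟨k, hpulls, hstart⟩ := h.pulls_eq_two_pow ht hK hnone c
  have hsum := h.sum_of_neighbouring hr ht c
  simp only [hpulls, hstart, mem_Ico_two_pow_half_iff] at hsum
  rw [privateMean_eq_div_card_episode_add hpulls hstart, privateMean_eq_div_card_episode_add
    (by rw [pulls_congr a r' r, hpulls]) (by rw [(start_current_congr a r' r t).1, hstart]), hsum]
  simp only [Pi.add_apply, noiseShift, Pi.single_apply, Prod.mk.injEq]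
  split_ifs with hck
  · rw [← hck.2]
    ring
  · ring

theorem Admissible.chooseArm_of_neighbouring (h : Admissible a r T)
    (hr : ∀ t, t ≠ j → r t = r' t) (Z : Fin K × ℕ → ℝ) {t : ℕ} (ht : t < T) :
    chooseArm ε α sel Z (stateAlong a r' t) t =
      chooseArm ε α sel (Z + noiseShift a r r' j) (stateAlong a r t) t := by
  by_cases hK : t < K
  · simp only [chooseArm, dif_pos hK]
  have hcur := (start_current_congr a r r' t).2
  rcases hc : (stateAlong a r t).current with _ | b
  · simp only [chooseArm, dif_neg hK, hc, ← hcur, pulls_congr a r' r,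
      h.privateMean_of_neighbouring hr Z ht.le (not_lt.1 hK) hc]
  · simp only [chooseArm, dif_neg hK, hc, ← hcur]

theorem abs_div_card_episode_le {x : ℝ} (hx : |x| ≤ 1) (k : ℕ) :
    |x / (episode k).card| ≤ 2 / 2 ^ k := by
  rw [abs_div, abs_of_pos (card_episode_pos k), ← one_div_div (2 ^ k : ℝ)]
  exact div_le_div₀ zero_le_one hx (by positivity) (half_two_pow_le_card_episode k)

theorem isGlobalDP_adaPKLUCB (hε : 0 < ε) (hsel : Measurable sel) (T : ℕ) :
    IsGlobalDP ε (adaPKLUCB K ε α sel T) := by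
  rintro a r r' hr hr' ⟨j, -, hj⟩
  have := isProbabilityMeasure_noiseLaw K hε
  rw [adaPKLUCB_eq (sel 0), adaPKLUCB_eq (sel 0)]
  set a₁ := extendFin (sel 0) a
  set r₁ := extendFin 0 r with hr₁
  set r₂ := extendFin 0 r' with hr₂
  rcases (actionEvent ε α sel a₁ r₁ T).eq_empty_or_nonempty with hempty | ⟨Z₀, hZ₀⟩
  · rw [hempty, measureReal_empty]
    exact mul_nonneg (Real.exp_pos ε).le measureReal_nonneg
  have hadm : Admissible a₁ r₁ T := Admissible.of_chooseArm (mem_actionEvent_iff.1 hZ₀)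
  have hne : ∀ t, t ≠ (j : ℕ) → r₁ t = r₂ t := by
    intro t ht
    simp only [hr₁, hr₂, extendFin]
    split_ifs
    · exact hj _ fun h => ht (congrArg Fin.val h)
    · rfl
  have hdiff : |r₂ j - r₁ j| ≤ 1 := by
    rw [hr₁, hr₂, extendFin_apply, extendFin_apply, abs_le]
    constructor <;> linarith [(hr j).1, (hr j).2, (hr' j).1, (hr' j).2]
  have hshift : {Z | Z + noiseShift a₁ r₁ r₂ j ∈ actionEvent ε α sel a₁ r₁ T} =
      actionEvent ε α sel a₁ r₂ T := by
    ext Z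
    rw [Set.mem_ofPred_eq, mem_actionEvent_iff, mem_actionEvent_iff]
    exact forall₂_congr fun t ht => by rw [hadm.chooseArm_of_neighbouring hne Z ht]
  rw [← hshift]
  exact noiseLaw_real_le_shift hε _ (abs_div_card_episode_le hdiff _)
    (measurableSet_actionEvent hsel a₁ r₁ T)

end Privacy

/-! ### Regret and the table of rewards -/

section CanonicalModel

variable {K T : ℕ} {ε α : ℝ} {sel : (Fin K → ℝ) → Fin K}

theorem actionEvent_congr {a a' : ℕ → Fin K} {r r' : ℕ → ℝ} (ha : ∀ t < T, a t = a' t)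
    (hr : ∀ t, t + 1 < T → r t = r' t) :
    actionEvent ε α sel a r T = actionEvent ε α sel a' r' T := by
  ext Z
  refine forall₂_congr fun t ht => ?_
  rw [runAction, runAction, runState_congr fun s hs => hr s (by omega), ha t ht]

theorem extendFin_snoc_of_lt {β : Type*} (d : β) (f : Fin T → β) (x : β) {n : ℕ} (h : n < T) :
    extendFin d (Fin.snoc f x : Fin (T + 1) → β) n = extendFin d f n := by
  rw [extendFin_of_lt _ _ h, extendFin_of_lt _ _ (Nat.lt_succ_of_lt h)]
  exact Fin.snoc_castSucc (α := fun _ => β) x f ⟨n, h⟩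

theorem extendFin_self {β : Type*} (d : β) (f : Fin T → β) : extendFin d f T = d :=
  dif_neg (lt_irrefl T)

theorem extendFin_snoc_self {β : Type*} (d : β) (f : Fin T → β) (x : β) :
    extendFin d (Fin.snoc f x : Fin (T + 1) → β) T = x := by
  rw [extendFin_of_lt _ _ (Nat.lt_succ_self T)]
  exact Fin.snoc_last (α := fun _ => β) x f

theorem adaPKLUCB_snoc (a : Fin T → Fin K) (r : Fin T → ℝ) (c : Fin K) (x : ℝ) :
    adaPKLUCB K ε α sel (T + 1) (Fin.snoc a c) (Fin.snoc r x) =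
      (noiseLaw K ε).real (actionEvent ε α sel (extendFin c a) (extendFin 0 r) (T + 1)) := by
  rw [adaPKLUCB_eq c]
  congr 1
  refine actionEvent_congr (fun t ht => ?_) fun t ht => extendFin_snoc_of_lt _ _ _ (by omega)
  rcases Nat.lt_succ_iff_lt_or_eq.1 ht with ht | rfl
  · exact extendFin_snoc_of_lt _ _ _ ht
  · rw [extendFin_snoc_self, extendFin_self]

theorem iUnion_actionEvent_succ (d : Fin K) (a : Fin T → Fin K) (r : ℕ → ℝ) :
    ⋃ c, actionEvent ε α sel (extendFin c a) r (T + 1) =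
      actionEvent ε α sel (extendFin d a) r T := by
  ext Z
  simp only [Set.mem_iUnion, actionEvent, Set.mem_ofPred_eq]
  constructor
  · rintro ⟨c, hc⟩ t ht
    rw [hc t (by omega), extendFin_of_lt _ _ ht, extendFin_of_lt _ _ ht]
  · refine fun h => ⟨runAction ε α sel Z r T, fun t ht => ?_⟩
    rcases Nat.lt_succ_iff_lt_or_eq.1 ht with ht | rfl
    · rw [h t ht, extendFin_of_lt _ _ ht, extendFin_of_lt _ _ ht]
    · rw [extendFin_self]

theorem sum_adaPKLUCB_snoc (hε : 0 < ε) (hsel : Measurable sel) (a : Fin T → Fin K)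
    (r : Fin T → ℝ) (x : ℝ) :
    ∑ c, adaPKLUCB K ε α sel (T + 1) (Fin.snoc a c) (Fin.snoc r x) =
      adaPKLUCB K ε α sel T a r := by
  have := isProbabilityMeasure_noiseLaw K hε
  rw [adaPKLUCB_eq (sel 0), ← iUnion_actionEvent_succ]
  simp only [adaPKLUCB_snoc]
  rw [measureReal_iUnion_fintype (fun c c' hc => Set.disjoint_left.2 fun Z hZ hZ' => hc ?_)
    fun c => measurableSet_actionEvent hsel _ _ _]
  have hlast := hZ T T.lt_succ_self
  rwa [hZ' T T.lt_succ_self, extendFin_self, extendFin_self, eq_comm] at hlast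

/-- Expectation of a function of the history in the canonical bandit model, as a linear
functional. -/
def historyExp (π : ActionLaw K T) (μ : Fin K → ℝ) :
    ((Fin T → Fin K) → (Fin T → Bool) → ℝ) →ₗ[ℝ] ℝ where
  toFun F := ∑ a, ∑ b, historyProb π μ a b * F a b
  map_add' F G := by simp only [Pi.add_apply, mul_add, Finset.sum_add_distrib]
  map_smul' x F := by
    simp only [Pi.smul_apply, smul_eq_mul, mul_left_comm _ x, ← Finset.mul_sum, RingHom.id_apply]

theorem historyExp_apply (π : ActionLaw K T) (μ : Fin K → ℝ)
    (F : (Fin T → Fin K) → (Fin T → Bool) → ℝ) :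
    historyExp π μ F = ∑ a, ∑ b, historyProb π μ a b * F a b := rfl

theorem rewardValue_snoc (b : Fin T → Bool) (β : Bool) :
    (fun t => rewardValue ((Fin.snoc b β : Fin (T + 1) → Bool) t)) =
      (Fin.snoc (fun t => rewardValue (b t)) (rewardValue β) : Fin (T + 1) → ℝ) :=
  Fin.comp_snoc rewardValue b β

theorem historyProb_snoc (π : ActionLaw K (T + 1)) (μ : Fin K → ℝ) (a : Fin T → Fin K)
    (b : Fin T → Bool) (c : Fin K) (β : Bool) :
    historyProb π μ (Fin.snoc a c) (Fin.snoc b β) =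
      π (Fin.snoc a c) (Fin.snoc (fun t => rewardValue (b t)) (rewardValue β)) *
        (∏ t, bernoulliMass (μ (a t)) (b t)) * bernoulliMass (μ c) β := by
  rw [historyProb, rewardValue_snoc, Fin.prod_univ_castSucc, mul_assoc]
  simp only [Fin.snoc_castSucc, Fin.snoc_last]

theorem sum_snoc {β : Type*} [Fintype β] (f : (Fin (T + 1) → β) → ℝ) :
    ∑ x, f x = ∑ x : Fin T → β, ∑ y, f (Fin.snoc x y) := by
  rw [← (Fin.snocEquiv fun _ : Fin (T + 1) => β).sum_comp, Fintype.sum_prod_type, Finset.sum_comm]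
  rfl

theorem historyExp_succ (hε : 0 < ε) (hsel : Measurable sel) (μ : Fin K → ℝ)
    {F : (Fin (T + 1) → Fin K) → (Fin (T + 1) → Bool) → ℝ}
    {G : (Fin T → Fin K) → (Fin T → Bool) → ℝ}
    (hFG : ∀ a b c, ∑ β, bernoulliMass (μ c) β * F (Fin.snoc a c) (Fin.snoc b β) = G a b) :
    historyExp (adaPKLUCB K ε α sel (T + 1)) μ F = historyExp (adaPKLUCB K ε α sel T) μ G := by
  rw [historyExp_apply, sum_snoc, historyExp_apply]
  refine Finset.sum_congr rfl fun a _ => ?_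
  simp only [sum_snoc, historyProb_snoc, adaPKLUCB_snoc]
  rw [Finset.sum_comm]
  refine Finset.sum_congr rfl fun b _ => ?_
  simp only [mul_assoc _ (bernoulliMass _ _) (F _ _), ← Finset.mul_sum, hFG]
  rw [← Finset.sum_mul, ← Finset.sum_mul, historyProb, ← sum_adaPKLUCB_snoc hε hsel a _ 0]
  simp only [adaPKLUCB_snoc]

theorem sum_bernoulliMass (p : ℝ) : ∑ β, bernoulliMass p β = 1 := by
  simp [bernoulliMass]

theorem sum_bernoulliMass_mul_rewardValue_sub (p : ℝ) :
    ∑ β, bernoulliMass p β * (rewardValue β - p) = 0 := by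
  simp [bernoulliMass, rewardValue]
  ring

theorem historyExp_one (hε : 0 < ε) (hsel : Measurable sel) (μ : Fin K → ℝ) :
    historyExp (adaPKLUCB K ε α sel T) μ (fun _ _ => 1) = 1 := by
  induction T with
  | zero =>
    have := isProbabilityMeasure_noiseLaw K hε
    simp [historyExp_apply, historyProb, adaPKLUCB]
  | succ T ih =>
    refine (historyExp_succ hε hsel μ fun _ _ c => ?_).trans ih
    simp only [mul_one, sum_bernoulliMass]

theorem historyExp_sum_rewardValue_sub (hε : 0 < ε) (hsel : Measurable sel) (μ : Fin K → ℝ) :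
    historyExp (adaPKLUCB K ε α sel T) μ (fun a b => ∑ t, (rewardValue (b t) - μ (a t))) = 0 := by
  induction T with
  | zero => simp [historyExp_apply]
  | succ T ih =>
    rw [← ih]
    refine historyExp_succ hε hsel μ fun a b c => ?_
    simp only [Fin.sum_univ_castSucc, Fin.snoc_castSucc, Fin.snoc_last, mul_add,
      Finset.sum_add_distrib, ← Finset.sum_mul, sum_bernoulliMass,
      sum_bernoulliMass_mul_rewardValue_sub, one_mul, add_zero]

theorem sum_gap_mul_card (μ : Fin K → ℝ) (a : Fin T → Fin K) :
    ∑ c, gap μ c * (Finset.univ.filter fun t => a t = c).card = T * bestMean μ - ∑ t, μ (a t) := by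
  have hfiber := Finset.sum_fiberwise' Finset.univ a (gap μ)
  simp only [Finset.sum_const, nsmul_eq_mul] at hfiber
  simp only [mul_comm (gap μ _), hfiber]
  simp only [gap, Finset.sum_sub_distrib, Finset.sum_const, Finset.card_univ, Fintype.card_fin,
    nsmul_eq_mul]

theorem regret_eq_sum_gap (hε : 0 < ε) (hsel : Measurable sel) (μ : Fin K → ℝ) (T : ℕ) :
    regret (adaPKLUCB K ε α sel T) μ =
      ∑ c, gap μ c * historyExp (adaPKLUCB K ε α sel T) μ
        fun a _ => (Finset.univ.filter fun t => a t = c).card := by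
  set E := historyExp (adaPKLUCB K ε α sel T) μ with hE
  set rewards : (Fin T → Fin K) → (Fin T → Bool) → ℝ := fun _ b => ∑ t, rewardValue (b t)
  have hsplit : (∑ c, gap μ c • fun (a : Fin T → Fin K) (_ : Fin T → Bool) =>
      ((Finset.univ.filter fun t => a t = c).card : ℝ)) =
      (T * bestMean μ) • (fun _ _ => 1) - rewards +
        fun a b => ∑ t, (rewardValue (b t) - μ (a t)) := by
    ext a b
    simp only [Finset.sum_apply, Pi.add_apply, Pi.sub_apply, Pi.smul_apply, smul_eq_mul,
      sum_gap_mul_card, Finset.sum_sub_distrib, rewards]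
    ring
  calc regret (adaPKLUCB K ε α sel T) μ = T * bestMean μ - E rewards := rfl
    _ = E (∑ c, gap μ c • fun a _ => ((Finset.univ.filter fun t => a t = c).card : ℝ)) := by
      rw [hsplit, map_add, map_sub, map_smul, hE, historyExp_one hε hsel,
        historyExp_sum_rewardValue_sub hε hsel, smul_eq_mul, mul_one, add_zero]
    _ = _ := by simp only [map_sum, map_smul, smul_eq_mul]

end CanonicalModel

section TableModel

variable {K T : ℕ} {ε α : ℝ} {sel : (Fin K → ℝ) → Fin K} {μ : Fin K → unitInterval}

/-- Law of the noise and of a table of rewards, in which the reward of the `(i + 1)`-th play of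
arm `c` is the entry `(c, i)`. -/
def tableLaw (ε : ℝ) (μ : Fin K → unitInterval) :
    Measure ((Fin K × ℕ → ℝ) × (Fin K × ℕ → Bool)) :=
  (noiseLaw K ε).prod (bernoulliPi fun i => μ i.1)

theorem isProbabilityMeasure_tableLaw (hε : 0 < ε) (μ : Fin K → unitInterval) :
    IsProbabilityMeasure (tableLaw ε μ) := by
  have := isProbabilityMeasure_noiseLaw K hε
  rw [tableLaw]
  infer_instance

/-- The memory after `t` rounds with actions `a` and binary rewards `b`. -/
abbrev boolState (a : ℕ → Fin K) (b : ℕ → Bool) (t : ℕ) : State K :=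
  stateAlong a (fun n => rewardValue (b n)) t

/-- The noise and the tables that lead to the actions `a` and the rewards `b`. -/
def tableEvent (ε α : ℝ) (sel : (Fin K → ℝ) → Fin K) (a : ℕ → Fin K) (b : ℕ → Bool) (T : ℕ) :
    Set ((Fin K × ℕ → ℝ) × (Fin K × ℕ → Bool)) :=
  actionEvent ε α sel a (fun n => rewardValue (b n)) T ×ˢ {X | ∀ t < T, X (slot a t) = b t}

theorem measurableSet_tableEvent (hsel : Measurable sel) (a : ℕ → Fin K) (b : ℕ → Bool) (T : ℕ) :
    MeasurableSet (tableEvent ε α sel a b T) := by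
  refine (measurableSet_actionEvent hsel _ _ _).prod ?_
  simp only [Set.ofPred_forall]
  exact MeasurableSet.iInter fun t => MeasurableSet.iInter fun _ =>
    measurableSet_eq_fun (measurable_pi_apply (slot a t)) measurable_const

theorem eq_of_mem_tableEvent {a a' : ℕ → Fin K} {b b' : ℕ → Bool}
    {ω : (Fin K × ℕ → ℝ) × (Fin K × ℕ → Bool)} (h : ω ∈ tableEvent ε α sel a b T)
    (h' : ω ∈ tableEvent ε α sel a' b' T) {t : ℕ} (ht : t < T) : a t = a' t ∧ b t = b' t := by
  induction t using Nat.strong_induction_on with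
  | _ t ih =>
    have ha : ∀ s < t, a s = a' s := fun s hs => (ih s hs (hs.trans ht)).1
    have hat : a t = a' t := by
      rw [← h.1 t ht, ← h'.1 t ht, runAction, runAction,
        runState_congr fun s hs => by rw [(ih s hs (hs.trans ht)).2]]
    refine ⟨hat, ?_⟩
    rw [← h.2 t ht, ← h'.2 t ht, slot_congr fun s hs => hs.lt_or_eq.elim (ha s) (· ▸ hat)]

theorem rewardValue_extendFin (b : Fin T → Bool) :
    (fun n => rewardValue (extendFin false b n)) = extendFin 0 fun t => rewardValue (b t) := by
  ext n
  by_cases hn : n < T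
  · rw [extendFin_of_lt _ _ hn, extendFin_of_lt _ _ hn]
  · simp only [extendFin, dif_neg hn, rewardValue, Bool.false_eq_true, if_false]

theorem bernoulliPi_real_slot_eq (a : ℕ → Fin K) (b : ℕ → Bool) (T : ℕ) :
    (bernoulliPi fun i : Fin K × ℕ => μ i.1).real {X | ∀ t < T, X (slot a t) = b t} =
      ∏ t ∈ Finset.range T, bernoulliMass (μ (a t)) (b t) := by
  have hinj := injective_slot a
  set y : Fin K × ℕ → Bool := Function.extend (slot a) b fun _ => false
  have hset : {X : Fin K × ℕ → Bool | ∀ t < T, X (slot a t) = b t} =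
      {X | ∀ i ∈ (Finset.range T).image (slot a), X i = y i} := by
    simp only [Finset.forall_mem_image, Finset.mem_range, y, hinj.extend_apply]
  rw [hset, bernoulliPi_real_forall_eq, Finset.prod_image hinj.injOn]
  exact Finset.prod_congr rfl fun t _ => congrArg _ (hinj.extend_apply b _ t)

theorem tableLaw_real_tableEvent (d : Fin K) (a : Fin T → Fin K) (b : Fin T → Bool) :
    (tableLaw ε μ).real (tableEvent ε α sel (extendFin d a) (extendFin false b) T) =
      historyProb (adaPKLUCB K ε α sel T) (fun c => μ c) a b := by
  rw [tableLaw, tableEvent, measureReal_prod_prod, historyProb, adaPKLUCB_eq d,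
    rewardValue_extendFin, bernoulliPi_real_slot_eq, Finset.prod_range]
  simp only [extendFin_apply]

theorem historyProb_nonneg (a : Fin T → Fin K) (b : Fin T → Bool) :
    0 ≤ historyProb (adaPKLUCB K ε α sel T) (fun c => μ c) a b := by
  rw [← tableLaw_real_tableEvent (sel 0)]
  exact measureReal_nonneg

theorem historyExp_mono {F G : (Fin T → Fin K) → (Fin T → Bool) → ℝ}
    (hFG : ∀ a b, F a b ≤ G a b) :
    historyExp (adaPKLUCB K ε α sel T) (fun c => μ c) F ≤
      historyExp (adaPKLUCB K ε α sel T) (fun c => μ c) G :=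
  Finset.sum_le_sum fun a _ => Finset.sum_le_sum fun b _ =>
    mul_le_mul_of_nonneg_left (hFG a b) (historyProb_nonneg a b)

theorem historyExp_indicator_le (hε : 0 < ε) (hsel : Measurable sel)
    (S : Set ((Fin T → Fin K) × (Fin T → Bool)))
    {E : Set ((Fin K × ℕ → ℝ) × (Fin K × ℕ → Bool))}
    (hE : ∀ p ∈ S, tableEvent ε α sel (extendFin (sel 0) p.1) (extendFin false p.2) T ⊆ E) :
    historyExp (adaPKLUCB K ε α sel T) (fun c => μ c) (fun a b => S.indicator 1 (a, b)) ≤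
      (tableLaw ε μ).real E := by
  classical
  have := isProbabilityMeasure_tableLaw hε μ
  have hsum : historyExp (adaPKLUCB K ε α sel T) (fun c => μ c)
      (fun a b => S.indicator 1 (a, b)) = ∑ p ∈ Finset.univ.filter (· ∈ S),
      (tableLaw ε μ).real
        (tableEvent ε α sel (extendFin (sel 0) p.1) (extendFin false p.2) T) := by
    simp only [historyExp_apply, tableLaw_real_tableEvent, Set.indicator_apply, Pi.one_apply,
      mul_ite, mul_one, mul_zero, Finset.sum_filter, Fintype.sum_prod_type]
  rw [hsum, ← measureReal_biUnion_finset]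
  · exact measureReal_mono (Set.iUnion₂_subset fun p hp => hE p (Finset.mem_filter.1 hp).2)
      (measure_ne_top _ _)
  · refine fun p _ p' _ hpp => Set.disjoint_left.2 fun ω hω hω' => hpp ?_
    have heq := fun t : Fin T => eq_of_mem_tableEvent hω hω' t.2
    simp only [extendFin_apply] at heq
    exact Prod.ext (funext fun t => (heq t).1) (funext fun t => (heq t).2)
  · exact fun p _ => measurableSet_tableEvent hsel _ _ _

theorem le_one_add_sum_two_pow {n T : ℕ} (hn : n ≤ T) :
    n ≤ 1 + ∑ k ∈ Finset.range (Nat.clog 2 T), if 2 ^ k < n then 2 ^ k else 0 := by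
  have hfilter : (Finset.range (Nat.clog 2 T)).filter (fun k => 2 ^ k < n) =
      Finset.range (Nat.clog 2 n) := by
    ext k
    rw [Finset.mem_filter, Finset.mem_range, Finset.mem_range, Nat.lt_clog_iff_pow_lt one_lt_two,
      Nat.lt_clog_iff_pow_lt one_lt_two]
    omega
  have hgeom : ∑ k ∈ Finset.range (Nat.clog 2 n), 2 ^ k = 2 ^ Nat.clog 2 n - 1 := by
    simpa using Nat.geomSum_eq le_rfl (Nat.clog 2 n)
  have hpow : n ≤ 2 ^ Nat.clog 2 n := Nat.le_pow_clog one_lt_two n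
  rw [← Finset.sum_filter, hfilter, hgeom]
  omega

theorem pulls_extendFin (d : Fin K) (a : Fin T → Fin K) (r : ℕ → ℝ) (c : Fin K) :
    (stateAlong (extendFin d a) r T).pulls c = (Finset.univ.filter fun t => a t = c).card := by
  rw [pulls_eq_card, Finset.card_filter, Finset.card_filter, Finset.sum_range]
  simp only [extendFin_apply]

theorem historyExp_pulls_le (hε : 0 < ε) (hsel : Measurable sel) (T : ℕ) (c : Fin K)
    (E : ℕ → Set ((Fin K × ℕ → ℝ) × (Fin K × ℕ → Bool)))
    (hE : ∀ k a b, 2 ^ k < (boolState a b T).pulls c → tableEvent ε α sel a b T ⊆ E k) :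
    historyExp (adaPKLUCB K ε α sel T) (fun c => μ c)
        (fun a _ => (Finset.univ.filter fun t => a t = c).card) ≤
      1 + ∑ k ∈ Finset.range (Nat.clog 2 T), 2 ^ k * (tableLaw ε μ).real (E k) := by
  set large : ℕ → Set ((Fin T → Fin K) × (Fin T → Bool)) :=
    fun k => {p | 2 ^ k < (Finset.univ.filter fun t => p.1 t = c).card} with hlarge
  have hcount : ∀ (a : Fin T → Fin K) (b : Fin T → Bool),
      ((Finset.univ.filter fun t => a t = c).card : ℝ) ≤ ((fun _ _ => 1) +
        ∑ k ∈ Finset.range (Nat.clog 2 T), (2 : ℝ) ^ k • fun a b =>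
          (large k).indicator 1 (a, b) : (Fin T → Fin K) → (Fin T → Bool) → ℝ) a b := by
    intro a b
    have hcard : (Finset.univ.filter fun t => a t = c).card ≤ T := by
      simpa using Finset.card_filter_le (Finset.univ : Finset (Fin T)) fun t => a t = c
    have := le_one_add_sum_two_pow hcard
    simp only [Pi.add_apply, Finset.sum_apply, Pi.smul_apply, smul_eq_mul, Set.indicator_apply,
      hlarge, Set.mem_ofPred_eq, Pi.one_apply, mul_ite, mul_one, mul_zero]
    exact_mod_cast this
  refine (historyExp_mono hcount).trans ?_
  rw [map_add, historyExp_one hε hsel, map_sum]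
  gcongr with k
  rw [map_smul, smul_eq_mul]
  gcongr
  exact historyExp_indicator_le hε hsel _ fun p hp => hE k _ _ (by rwa [pulls_extendFin])

end TableModel

/-! ### Why a suboptimal arm is played -/

section Events

variable {K : ℕ} {ε α : ℝ} {μ : Fin K → unitInterval}

/-- Mean reward of arm `c` over its episode that ends after `2 ^ k` plays. -/
def episodeMean (X : Fin K × ℕ → Bool) (c : Fin K) (k : ℕ) : ℝ :=
  (∑ i ∈ episode k, rewardValue (X (c, i))) / (episode k).card

/-- The table entries that arm `c` consumes in its episode that ends after `2 ^ k` plays. -/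
def episodeEntries (c : Fin K) (k : ℕ) : Finset (Fin K × ℕ) := {c} ×ˢ episode k

theorem fst_eq_of_mem_episodeEntries {c : Fin K} {k : ℕ} {i : Fin K × ℕ}
    (hi : i ∈ episodeEntries c k) : i.1 = c :=
  Finset.mem_singleton.1 (Finset.mem_product.1 hi).1

theorem card_episodeEntries (c : Fin K) (k : ℕ) :
    (episodeEntries c k).card = (episode k).card := by
  rw [episodeEntries, Finset.card_product, Finset.card_singleton, one_mul]

theorem episodeEntries_nonempty (c : Fin K) (k : ℕ) : (episodeEntries c k).Nonempty := by
  rw [← Finset.card_pos, card_episodeEntries]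
  exact_mod_cast card_episode_pos k

theorem episodeMean_eq (X : Fin K × ℕ → Bool) (c : Fin K) (k : ℕ) :
    episodeMean X c k =
      (∑ i ∈ episodeEntries c k, rewardValue (X i)) / (episodeEntries c k).card := by
  rw [card_episodeEntries, episodeMean, episodeEntries, Finset.sum_product, Finset.sum_singleton]

theorem episodeMean_mem (X : Fin K × ℕ → Bool) (c : Fin K) (k : ℕ) :
    episodeMean X c k ∈ Set.Icc (0 : ℝ) 1 := by
  rw [episodeMean_eq]
  have hsum := sum_rewardValue_mem X (episodeEntries c k)
  exact ⟨div_nonneg hsum.1 (Nat.cast_nonneg _), div_le_one_of_le₀ hsum.2 (Nat.cast_nonneg _)⟩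

/-- The deviations that are necessary for the index of arm `o` to be below `m` in some round from
`n` on at which the arm was played `2 ^ j` times: the noise outweighs the bonus of the private mean,
or the empirical mean is far below `m` in relative entropy. -/
def underEvent (ε α m : ℝ) (o : Fin K) (j n : ℕ) :
    Set ((Fin K × ℕ → ℝ) × (Fin K × ℕ → Bool)) :=
  {ω | ω.1 (o, j) < -(α * Real.log n / (ε * (1 / 2 * (2 ^ j : ℕ))))} ∪
    {ω | episodeMean ω.2 o j < m ∧
      ((α * Real.log n / (1 / 2 * (2 ^ j : ℕ)) : ℝ) : EReal) < klBer (episodeMean ω.2 o j) m}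

/-- The index of arm `c` is at least `m` in some round up to `T` at which the arm was played `2 ^ k`
times. -/
def overEvent (ε α m : ℝ) (T : ℕ) (c : Fin K) (k : ℕ) :
    Set ((Fin K × ℕ → ℝ) × (Fin K × ℕ → Bool)) :=
  {ω | ∃ n, 1 ≤ n ∧ n ≤ T ∧ m ≤ klIndex ε α n (2 ^ k) (episodeMean ω.2 c k + ω.1 (c, k))}

theorem tableLaw_real_fst (ε : ℝ) (μ : Fin K → unitInterval) (S : Set (Fin K × ℕ → ℝ)) :
    (tableLaw ε μ).real {ω | ω.1 ∈ S} = (noiseLaw K ε).real S := by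
  have hprod : {ω : (Fin K × ℕ → ℝ) × (Fin K × ℕ → Bool) | ω.1 ∈ S} = S ×ˢ Set.univ :=
    Set.prod_univ.symm
  rw [hprod, tableLaw, measureReal_prod_prod, probReal_univ, mul_one]

theorem tableLaw_real_snd (hε : 0 < ε) (μ : Fin K → unitInterval) (S : Set (Fin K × ℕ → Bool)) :
    (tableLaw ε μ).real {ω | ω.2 ∈ S} = (bernoulliPi fun i : Fin K × ℕ => μ i.1).real S := by
  have := isProbabilityMeasure_noiseLaw K hε
  have hprod : {ω : (Fin K × ℕ → ℝ) × (Fin K × ℕ → Bool) | ω.2 ∈ S} = Set.univ ×ˢ S :=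
    Set.univ_prod.symm
  rw [hprod, tableLaw, measureReal_prod_prod, probReal_univ, one_mul]

theorem tableLaw_real_noise_lt (hε : 0 < ε) (hα : 0 ≤ α) (μ : Fin K → unitInterval) (o : Fin K)
    (j n : ℕ) :
    (tableLaw ε μ).real {ω | ω.1 (o, j) < -(α * Real.log n / (ε * (1 / 2 * (2 ^ j : ℕ))))} =
      Real.exp (-(α * Real.log n)) / 2 := by
  refine (tableLaw_real_fst ε μ
    {Z | Z (o, j) < -(α * Real.log n / (ε * (1 / 2 * (2 ^ j : ℕ))))}).trans ?_
  rw [noiseLaw_real_lt hε (o, j)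
    (div_nonneg (mul_nonneg hα (Real.log_natCast_nonneg n)) (by positivity))]
  congr 3
  push_cast
  field_simp

theorem tableLaw_real_klBer_episodeMean_gt (hε : 0 < ε) (hα : 0 ≤ α) (μ : Fin K → unitInterval)
    (o : Fin K) (j n : ℕ) :
    (tableLaw ε μ).real {ω | episodeMean ω.2 o j < μ o ∧
      ((α * Real.log n / (1 / 2 * (2 ^ j : ℕ)) : ℝ) : EReal) <
        klBer (episodeMean ω.2 o j) (μ o)} ≤ Real.exp (-(α * Real.log n)) := by
  have hlog : 0 ≤ α * Real.log n := mul_nonneg hα (Real.log_natCast_nonneg n)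
  refine (tableLaw_real_snd hε μ {X | episodeMean X o j < μ o ∧
    ((α * Real.log n / (1 / 2 * (2 ^ j : ℕ)) : ℝ) : EReal) <
      klBer (episodeMean X o j) (μ o)}).trans_le ?_
  simp only [episodeMean_eq]
  refine (bernoulliPi_real_klBer_gt (μ := fun i : Fin K × ℕ => μ i.1)
    (fun i hi => congrArg μ (fst_eq_of_mem_episodeEntries hi))
    (episodeEntries_nonempty o j) _).trans (Real.exp_le_exp.2 (neg_le_neg ?_))
  have hhalf := half_two_pow_le_card_episode j
  rw [card_episodeEntries, ← mul_div_assoc, le_div_iff₀ (by positivity), mul_comm _ (α * _)]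
  refine mul_le_mul_of_nonneg_left ?_ hlog
  push_cast
  linarith

theorem tableLaw_real_underEvent_le (hε : 0 < ε) (hα : 0 ≤ α) (μ : Fin K → unitInterval)
    (o : Fin K) (j n : ℕ) :
    (tableLaw ε μ).real (underEvent ε α (μ o) o j n) ≤ 3 / 2 * Real.exp (-(α * Real.log n)) := by
  have := isProbabilityMeasure_tableLaw hε μ
  refine (measureReal_union_le _ _).trans ?_
  rw [tableLaw_real_noise_lt hε hα μ o j n]
  linarith [tableLaw_real_klBer_episodeMean_gt hε hα μ o j n]

theorem underEvent_anti (hε : 0 < ε) (hα : 0 ≤ α) (m : ℝ) (o : Fin K) (j : ℕ) {n n' : ℕ}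
    (hn : 0 < n) (h : n ≤ n') : underEvent ε α m o j n' ⊆ underEvent ε α m o j n := by
  have hlog : Real.log n ≤ Real.log n' :=
    Real.log_le_log (by exact_mod_cast hn) (by exact_mod_cast h)
  refine Set.union_subset_union (fun ω hω => ?_) fun ω hω => ⟨hω.1, ?_⟩
  · rw [Set.mem_ofPred_eq] at hω ⊢
    exact hω.trans_le (neg_le_neg (div_le_div_of_nonneg_right
      (mul_le_mul_of_nonneg_left hlog hα) (mul_nonneg hε.le (by positivity))))
  · refine lt_of_le_of_lt (EReal.coe_le_coe_iff.2 ?_) hω.2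
    gcongr

theorem mem_underEvent_of_klIndex_lt (hα : 0 ≤ α) {m : ℝ}
    (hm : m ∈ Set.Icc (0 : ℝ) 1) {o : Fin K} {j n : ℕ}
    {ω : (Fin K × ℕ → ℝ) × (Fin K × ℕ → Bool)}
    (hlt : klIndex ε α n (2 ^ j) (episodeMean ω.2 o j + ω.1 (o, j)) < m) :
    ω ∈ underEvent ε α m o j n := by
  have hlog : 0 ≤ Real.log n := Real.log_natCast_nonneg n
  rw [klIndex_eq_klUpper] at hlt
  obtain ⟨hclip, hkl⟩ := lt_klBer_of_klUpper_lt (clip_mem _) (by positivity) hm hlt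
  refine or_iff_not_imp_left.2 fun hnoise => ?_
  rw [Set.mem_ofPred_eq, not_lt] at hnoise
  have hmem := episodeMean_mem ω.2 o j
  have hle : episodeMean ω.2 o j ≤ clip (episodeMean ω.2 o j + ω.1 (o, j) +
      α * Real.log n / (ε * (1 / 2 * (2 ^ j : ℕ)))) :=
    (clip_of_mem hmem).ge.trans (monotone_clip (by linarith))
  exact ⟨hle.trans_lt hclip, hkl.trans_le (klBer_anti_left hmem.1 hle hclip.le hm.2)⟩

end Events

section Plays

variable {K : ℕ} {ε α : ℝ} {sel : (Fin K → ℝ) → Fin K} {r : ℕ → ℝ} {a : ℕ → Fin K} {T : ℕ}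

theorem exists_play_of_lt_pulls {n : ℕ} {c : Fin K} (h : n < (stateAlong a r T).pulls c) :
    ∃ t < T, a t = c ∧ (stateAlong a r t).pulls c = n := by
  induction T with
  | zero => exact absurd h (Nat.not_lt_zero n)
  | succ T ih =>
    rcases lt_or_ge n ((stateAlong a r T).pulls c) with hlt | hge
    · obtain ⟨t, ht, hplay⟩ := ih hlt
      exact ⟨t, ht.trans T.lt_succ_self, hplay⟩
    · rw [stateAlong] at h
      obtain rfl : c = a T := by
        by_contra hne
        rw [updateState_pulls_of_ne _ _ hne] at h
        omega
      rw [updateState_pulls_self] at h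
      exact ⟨T, T.lt_succ_self, rfl, by omega⟩

theorem Admissible.opening_of_pulls_eq_two_pow (h : Admissible a r T) {t k : ℕ} (ht : t < T)
    (hpulls : (stateAlong a r t).pulls (a t) = 2 ^ k) :
    K ≤ t ∧ (stateAlong a r t).current = none := by
  have hpos : 0 < 2 ^ k := Nat.two_pow_pos k
  constructor
  · by_contra! hlt
    have hfirst := ((h.initial ht.le hlt.le).2 (a t)).1
    rw [hpulls, (h t ht).1 hlt, if_neg (lt_irrefl t)] at hfirst
    omega
  · refine (h.current_eq ht).resolve_right fun hcur => ?_
    obtain ⟨i, -, hlt, hlt'⟩ := (h.doublingInvariant ht.le).busy (a t) hcur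
    rw [hpulls, Nat.pow_lt_pow_iff_right one_lt_two] at hlt hlt'
    omega

theorem Admissible.privateMean_eq {X : Fin K × ℕ → Bool} (h : Admissible a r T)
    (hX : ∀ t < T, r t = rewardValue (X (slot a t))) (Z : Fin K × ℕ → ℝ) {t : ℕ} (ht : t ≤ T)
    (hK : K ≤ t) (hnone : (stateAlong a r t).current = none) (c : Fin K) :
    ∃ j, (stateAlong a r t).pulls c = 2 ^ j ∧
      privateMean Z (stateAlong a r t) c = episodeMean X c j + Z (c, j) := by
  obtain ⟨j, hpulls, hstart⟩ := h.pulls_eq_two_pow ht hK hnone c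
  refine ⟨j, hpulls, ?_⟩
  rw [privateMean_eq_div_card_episode_add hpulls hstart,
    h.sum_eq (Y := fun i => rewardValue (X i)) hX ht, hpulls, hstart]
  rfl

theorem klIndex_le_klIndex_of_opening {Z : Fin K × ℕ → ℝ} {s : State K} {t : ℕ}
    (hargmax : ∀ (x : Fin K → ℝ) (c : Fin K), x c ≤ x (sel x)) (hK : K ≤ t)
    (hnone : s.current = none) (o : Fin K) :
    klIndex ε α (t + 1) (s.pulls o) (privateMean Z s o) ≤
      klIndex ε α (t + 1) (s.pulls (chooseArm ε α sel Z s t))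
        (privateMean Z s (chooseArm ε α sel Z s t)) := by
  have hchoose : chooseArm ε α sel Z s t =
      sel fun c => klIndex ε α (t + 1) (s.pulls c) (privateMean Z s c) := by
    simp only [chooseArm, dif_neg hK.not_gt, hnone]
  rw [hchoose]
  exact hargmax (fun c => klIndex ε α (t + 1) (s.pulls c) (privateMean Z s c)) o

theorem mem_underEvent_or_mem_overEvent (hε : 0 < ε) (hα : 0 ≤ α)
    (hargmax : ∀ (x : Fin K → ℝ) (c : Fin K), x c ≤ x (sel x)) {m : ℝ}
    (hm : m ∈ Set.Icc (0 : ℝ) 1) {o c : Fin K} (hoc : o ≠ c) {b : ℕ → Bool} {k : ℕ}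
    (hk : 2 ^ k < (boolState a b T).pulls c) {ω : (Fin K × ℕ → ℝ) × (Fin K × ℕ → Bool)}
    (hω : ω ∈ tableEvent ε α sel a b T) :
    (∃ j, 2 ^ j < T ∧ ω ∈ underEvent ε α m o j (2 ^ j + 2 ^ k + 1)) ∨
      ω ∈ overEvent ε α m T c k := by
  have hchoose := mem_actionEvent_iff.1 hω.1
  have hadm := Admissible.of_chooseArm hchoose
  obtain ⟨t, htT, rfl, hpulls⟩ := exists_play_of_lt_pulls hk
  obtain ⟨hK, hnone⟩ := hadm.opening_of_pulls_eq_two_pow htT hpulls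
  have hX : ∀ s < T, rewardValue (b s) = rewardValue (ω.2 (slot a s)) :=
    fun s hs => by rw [hω.2 s hs]
  obtain ⟨j, hj, hmean_o⟩ := hadm.privateMean_eq hX ω.1 htT.le hK hnone o
  obtain ⟨k', hk', hmean_a⟩ := hadm.privateMean_eq hX ω.1 htT.le hK hnone (a t)
  obtain rfl : k = k' := Nat.pow_right_injective le_rfl (hpulls.symm.trans hk')
  have htime : 2 ^ j + 2 ^ k ≤ t := by
    have hpair := Finset.sum_le_sum_of_subset (f := (boolState a b t).pulls)
      (Finset.subset_univ {o, a t})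
    rwa [Finset.sum_pair hoc, sum_pulls, hj, hpulls] at hpair
  have hindex := klIndex_le_klIndex_of_opening (ε := ε) (α := α) (Z := ω.1) hargmax hK hnone o
  rw [hchoose t htT, hj, hmean_o, hmean_a, hpulls] at hindex
  rcases lt_or_ge (klIndex ε α (t + 1) (2 ^ j) (episodeMean ω.2 o j + ω.1 (o, j))) m
    with hlt | hge
  · have := Nat.two_pow_pos k
    exact Or.inl ⟨j, by omega, underEvent_anti hε hα m o j (Nat.succ_pos _)
      (Nat.succ_le_succ htime) (mem_underEvent_of_klIndex_lt hα hm hlt)⟩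
  · exact Or.inr ⟨t + 1, by omega, by omega, hge.trans hindex⟩

end Plays

/-! ### Sums over dyadic scales -/

section DyadicSums

theorem sum_two_pow_filter_le {N : ℝ} (hN : 0 ≤ N) (n : ℕ) :
    ∑ k ∈ Finset.range n, (if (2 : ℝ) ^ k < N then (2 : ℝ) ^ k else 0) ≤ 2 * N := by
  suffices h : ∑ k ∈ Finset.range n, (if (2 : ℝ) ^ k < N then (2 : ℝ) ^ k else 0) ≤ 2 * N ∧
      ∑ k ∈ Finset.range n, (if (2 : ℝ) ^ k < N then (2 : ℝ) ^ k else 0) ≤ 2 ^ n from h.1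
  induction n with
  | zero => simpa using hN
  | succ n ih =>
    have hpow : (0 : ℝ) < 2 ^ n := by positivity
    rw [Finset.sum_range_succ, pow_succ]
    split_ifs with h
    · constructor <;> linarith [ih.2]
    · constructor <;> linarith [ih.1, ih.2]

theorem sum_two_pow_clog_le (T : ℕ) :
    ∑ k ∈ Finset.range (Nat.clog 2 T), (2 : ℝ) ^ k ≤ 2 * T := by
  refine (Finset.sum_congr rfl fun k hk => ?_).trans_le
    (sum_two_pow_filter_le (Nat.cast_nonneg T) (Nat.clog 2 T))
  have hlt := (Nat.lt_clog_iff_pow_lt one_lt_two).1 (Finset.mem_range.1 hk)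
  exact (if_pos (by exact_mod_cast hlt)).symm

theorem mul_exp_neg_le (y : ℝ) :
    y * Real.exp (-y) ≤ 2 * (Real.exp (-(y / 2)) - Real.exp (-y)) := by
  have hsq : Real.exp (-y) = Real.exp (-(y / 2)) * Real.exp (-(y / 2)) := by
    rw [← Real.exp_add]
    ring_nf
  have hinv : Real.exp (y / 2) * Real.exp (-(y / 2)) = 1 := by
    rw [← Real.exp_add, add_neg_cancel, Real.exp_zero]
  have hle := mul_le_mul_of_nonneg_right (Real.add_one_le_exp (y / 2)) (Real.exp_pos (-y)).le
  rw [hsq] at hle ⊢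
  rw [← mul_assoc (Real.exp (y / 2)), hinv] at hle
  linarith

theorem sum_two_pow_mul_exp_le {z : ℝ} (hz : 0 < z) (n : ℕ) :
    ∑ k ∈ Finset.range n, (2 : ℝ) ^ k * Real.exp (-(2 ^ k * z)) ≤ 2 / z := by
  set e : ℕ → ℝ := fun k => Real.exp (-(2 ^ k * z / 2)) with he
  have hterm (k : ℕ) : (2 : ℝ) ^ k * Real.exp (-(2 ^ k * z)) ≤ 2 / z * (e k - e (k + 1)) := by
    have hsucc : e (k + 1) = Real.exp (-(2 ^ k * z)) := by
      simp only [he, pow_succ]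
      ring_nf
    rw [hsucc, div_mul_eq_mul_div, le_div_iff₀ hz, mul_right_comm]
    exact mul_exp_neg_le (2 ^ k * z)
  have hzero : e 0 ≤ 1 := Real.exp_le_one_iff.2 (neg_nonpos.2 (by positivity))
  have hn : 0 < e n := Real.exp_pos _
  calc ∑ k ∈ Finset.range n, (2 : ℝ) ^ k * Real.exp (-(2 ^ k * z))
      ≤ ∑ k ∈ Finset.range n, 2 / z * (e k - e (k + 1)) := Finset.sum_le_sum fun k _ => hterm k
    _ = 2 / z * (e 0 - e n) := by rw [← Finset.mul_sum, Finset.sum_range_sub']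
    _ ≤ 2 / z * 1 := by gcongr; linarith
    _ = 2 / z := mul_one _

theorem sum_one_div_two_pow_le (n : ℕ) : ∑ j ∈ Finset.range n, (1 : ℝ) / 2 ^ j ≤ 2 := by
  simpa only [one_div, inv_pow] using sum_geometric_two_le n

theorem sum_two_pow_div_sq_le (n : ℕ) :
    ∑ k ∈ Finset.range n, (2 : ℝ) ^ k * (4 / 9 / ((2 : ℝ) ^ k + 1) ^ 2) ≤ 5 / 9 := by
  rcases n with _ | n
  · norm_num
  have hterm (k : ℕ) :
      (2 : ℝ) ^ (k + 1) * (4 / 9 / ((2 : ℝ) ^ (k + 1) + 1) ^ 2) ≤ 2 / 9 * (1 / 2 ^ k) := by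
    have hpow : (0 : ℝ) < 2 ^ k := by positivity
    rw [pow_succ, div_div, mul_one_div, ← mul_div_assoc,
      div_le_div_iff₀ (by positivity) (by positivity)]
    nlinarith
  have hsum := Finset.sum_le_sum fun k (_ : k ∈ Finset.range n) => hterm k
  rw [← Finset.mul_sum] at hsum
  rw [Finset.sum_range_succ']
  norm_num only [pow_zero]
  linarith [sum_one_div_two_pow_le n]

theorem sum_two_pow_div_sq_pred_le (n : ℕ) :
    ∑ k ∈ Finset.range n, (2 : ℝ) ^ k * (4 / 9 / ((2 : ℝ) ^ (k - 1) + 1) ^ 2) ≤ 11 / 9 := by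
  rcases n with _ | n
  · norm_num
  have hshift : ∑ k ∈ Finset.range n, (2 : ℝ) ^ (k + 1) *
      (4 / 9 / ((2 : ℝ) ^ (k + 1 - 1) + 1) ^ 2) =
      2 * ∑ k ∈ Finset.range n, (2 : ℝ) ^ k * (4 / 9 / ((2 : ℝ) ^ k + 1) ^ 2) := by
    rw [Finset.mul_sum]
    exact Finset.sum_congr rfl fun k _ => by rw [Nat.add_sub_cancel, pow_succ]; ring
  rw [Finset.sum_range_succ', hshift]
  norm_num
  linarith [sum_two_pow_div_sq_le n]

/-- The number of plays of an arm in its episodes that end after `2 ^ k` and `2 ^ (k - 1)` plays;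
these episodes coincide for `k = 0`. -/
def lastTwo : ℕ → ℕ
  | 0 => 1
  | 1 => 2
  | k + 2 => 3 * 2 ^ k

theorem one_sub_mul_mul_pow_le {q : ℝ} (hq : 0 ≤ q) (hq1 : q ≤ 1) (n : ℕ) :
    (1 - q) * (n * q ^ n) ≤ 1 - q ^ n := by
  have hle := Finset.card_nsmul_le_sum (Finset.range n) (fun i => q ^ i) (q ^ n)
    fun i hi => pow_le_pow_of_le_one hq hq1 (Finset.mem_range.1 hi).le
  rw [Finset.card_range, nsmul_eq_mul] at hle
  rw [← mul_neg_geom_sum]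
  exact mul_le_mul_of_nonneg_left hle (sub_nonneg.2 hq1)

theorem sum_two_pow_mul_pow_three_mul_le {q : ℝ} (hq : 0 ≤ q) (hq1 : q ≤ 1) (n : ℕ) :
    (1 - q) * ∑ i ∈ Finset.range n, (2 : ℝ) ^ (i + 3) * q ^ (3 * 2 ^ (i + 1)) ≤ 8 / 3 * q ^ 3 := by
  have hterm (i : ℕ) : (1 - q) * ((2 : ℝ) ^ (i + 3) * q ^ (3 * 2 ^ (i + 1))) ≤
      8 / 3 * (q ^ (3 * 2 ^ i) - q ^ (3 * 2 ^ (i + 1))) := by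
    have hcoeff : (2 : ℝ) ^ (i + 3) = 8 / 3 * (3 * 2 ^ i : ℕ) := by
      push_cast
      ring
    rw [hcoeff, show 3 * 2 ^ (i + 1) = 3 * 2 ^ i + 3 * 2 ^ i by ring, pow_add]
    have hle := mul_le_mul_of_nonneg_right (one_sub_mul_mul_pow_le hq hq1 (3 * 2 ^ i))
      (pow_nonneg hq (3 * 2 ^ i))
    linarith
  rw [Finset.mul_sum]
  refine (Finset.sum_le_sum fun i _ => hterm i).trans ?_
  rw [← Finset.mul_sum, Finset.sum_range_sub' (fun i => q ^ (3 * 2 ^ i)), pow_zero, mul_one]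
  linarith [pow_nonneg hq (3 * 2 ^ n)]

theorem sum_two_pow_mul_pow_lastTwo_le {q : ℝ} (hq : 0 ≤ q) (hq1 : q ≤ 1) (n : ℕ) :
    (1 - q) * ∑ k ∈ Finset.range n, (2 : ℝ) ^ k * q ^ lastTwo k ≤
      (1 - q) * (q + 2 * q ^ 2 + 4 * q ^ 3) + 8 / 3 * q ^ 3 := by
  have hsplit : ∑ k ∈ Finset.range (n + 3), (2 : ℝ) ^ k * q ^ lastTwo k =
      ∑ i ∈ Finset.range n, (2 : ℝ) ^ (i + 3) * q ^ (3 * 2 ^ (i + 1)) +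
        (q + 2 * q ^ 2 + 4 * q ^ 3) := by
    rw [Finset.sum_range_succ', Finset.sum_range_succ', Finset.sum_range_succ']
    simp only [lastTwo]
    norm_num
    ring
  calc (1 - q) * ∑ k ∈ Finset.range n, (2 : ℝ) ^ k * q ^ lastTwo k
      ≤ (1 - q) * ∑ k ∈ Finset.range (n + 3), (2 : ℝ) ^ k * q ^ lastTwo k :=
        mul_le_mul_of_nonneg_left (Finset.sum_le_sum_of_subset_of_nonneg
          (Finset.range_mono (by omega)) fun _ _ _ => by positivity) (sub_nonneg.2 hq1)
    _ ≤ (1 - q) * (q + 2 * q ^ 2 + 4 * q ^ 3) + 8 / 3 * q ^ 3 := by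
        rw [hsplit, mul_add]
        linarith [sum_two_pow_mul_pow_three_mul_le hq hq1 n]

end DyadicSums

/-! ### Probability that the index of an optimal arm is too small -/

section UnderUnion

variable {K : ℕ} {ε α : ℝ}

/-- The deviations that are necessary for the index of arm `o` to be below `m` in some round at
which arm `o` was played `2 ^ j` times for some `j < n` and some other arm was played `2 ^ k` times:
such a round is preceded by at least `2 ^ j + 2 ^ k` rounds. -/
def underUnion (ε α m : ℝ) (o : Fin K) (n k : ℕ) :
    Set ((Fin K × ℕ → ℝ) × (Fin K × ℕ → Bool)) :=
  ⋃ j ∈ Finset.range n, underEvent ε α m o j (2 ^ j + 2 ^ k + 1)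

theorem underUnion_anti (hε : 0 < ε) (hα : 0 ≤ α) (m : ℝ) (o : Fin K) (n : ℕ) {k k' : ℕ}
    (h : k ≤ k') : underUnion ε α m o n k' ⊆ underUnion ε α m o n k := by
  refine Set.iUnion₂_mono fun j _ => underEvent_anti hε hα m o j (Nat.succ_pos _) ?_
  have := Nat.pow_le_pow_right two_pos h
  omega

theorem exp_neg_mul_log_le {n : ℕ} (hn : 0 < n) {d : ℕ} (hα : d ≤ α) :
    Real.exp (-(α * Real.log n)) ≤ 1 / (n : ℝ) ^ d := by
  have hpow : Real.exp (d * Real.log n) = (n : ℝ) ^ d := by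
    rw [Real.exp_nat_mul, Real.exp_log (by exact_mod_cast hn)]
  rw [← hpow, one_div, ← Real.exp_neg]
  exact Real.exp_le_exp.2
    (neg_le_neg (mul_le_mul_of_nonneg_right hα (Real.log_natCast_nonneg n)))

theorem sq_mul_le_add_cube {A B : ℝ} (hA : 0 ≤ A) (hB : 0 ≤ B) :
    27 / 4 * (A ^ 2 * B) ≤ (A + B) ^ 3 := by
  have hfactor : (A + B) ^ 3 - 27 / 4 * (A ^ 2 * B) = (A - 2 * B) ^ 2 * (A + B / 4) := by ring
  rw [← sub_nonneg, hfactor]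
  positivity

theorem tableLaw_real_underUnion_le (hε : 0 < ε) (hα : 3 ≤ α) (μ : Fin K → unitInterval)
    (o : Fin K) (n k : ℕ) :
    (tableLaw ε μ).real (underUnion ε α (μ o) o n k) ≤ 4 / 9 / ((2 : ℝ) ^ k + 1) ^ 2 := by
  have hterm (j : ℕ) : (tableLaw ε μ).real (underEvent ε α (μ o) o j (2 ^ j + 2 ^ k + 1)) ≤
      2 / 9 / ((2 : ℝ) ^ k + 1) ^ 2 * (1 / 2 ^ j) := by
    have hcube : 27 / 4 * (((2 : ℝ) ^ k + 1) ^ 2 * 2 ^ j) ≤ (2 ^ j + 2 ^ k + 1 : ℕ) ^ 3 := by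
      refine (sq_mul_le_add_cube (by positivity) (by positivity)).trans_eq ?_
      push_cast
      ring
    calc (tableLaw ε μ).real (underEvent ε α (μ o) o j (2 ^ j + 2 ^ k + 1))
        ≤ 3 / 2 * Real.exp (-(α * Real.log (2 ^ j + 2 ^ k + 1 : ℕ))) :=
          tableLaw_real_underEvent_le hε (by linarith) μ o j _
      _ ≤ 3 / 2 * (1 / ((2 ^ j + 2 ^ k + 1 : ℕ) : ℝ) ^ 3) := by
          gcongr
          exact exp_neg_mul_log_le (Nat.succ_pos _) (by exact_mod_cast hα)
      _ ≤ 3 / 2 * (1 / (27 / 4 * (((2 : ℝ) ^ k + 1) ^ 2 * 2 ^ j))) := by gcongr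
      _ = 2 / 9 / ((2 : ℝ) ^ k + 1) ^ 2 * (1 / 2 ^ j) := by
          field_simp
          norm_num
  refine (measureReal_biUnion_finset_le _ _).trans ((Finset.sum_le_sum fun j _ => hterm j).trans ?_)
  rw [← Finset.mul_sum]
  calc 2 / 9 / ((2 : ℝ) ^ k + 1) ^ 2 * ∑ j ∈ Finset.range n, (1 : ℝ) / 2 ^ j
      ≤ 2 / 9 / ((2 : ℝ) ^ k + 1) ^ 2 * 2 := by
        gcongr
        exact sum_one_div_two_pow_le n
    _ = 4 / 9 / ((2 : ℝ) ^ k + 1) ^ 2 := by ring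

variable {sel : (Fin K → ℝ) → Fin K} {T : ℕ}

theorem tableEvent_subset_underUnion_union_overEvent (hε : 0 < ε) (hα : 0 ≤ α)
    (hargmax : ∀ (x : Fin K → ℝ) (c : Fin K), x c ≤ x (sel x)) {m : ℝ}
    (hm : m ∈ Set.Icc (0 : ℝ) 1) {o c : Fin K} (hoc : o ≠ c) {a : ℕ → Fin K}
    {b : ℕ → Bool} {k : ℕ} (hk : 2 ^ k < (boolState a b T).pulls c) :
    tableEvent ε α sel a b T ⊆
      underUnion ε α m o (Nat.clog 2 T) k ∪ overEvent ε α m T c k := by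
  intro ω hω
  rcases mem_underEvent_or_mem_overEvent hε hα hargmax hm hoc hk hω with ⟨j, hj, hunder⟩ | hover
  · exact Or.inl (Set.mem_biUnion
      (Finset.mem_range.2 ((Nat.lt_clog_iff_pow_lt one_lt_two).2 hj)) hunder)
  · exact Or.inr hover

theorem tableEvent_subset_underUnion_union_inter_overEvent (hε : 0 < ε) (hα : 0 ≤ α)
    (hargmax : ∀ (x : Fin K → ℝ) (c : Fin K), x c ≤ x (sel x)) {m : ℝ}
    (hm : m ∈ Set.Icc (0 : ℝ) 1) {o c : Fin K} (hoc : o ≠ c) {a : ℕ → Fin K}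
    {b : ℕ → Bool} {k : ℕ} (hk : 2 ^ k < (boolState a b T).pulls c) :
    tableEvent ε α sel a b T ⊆ underUnion ε α m o (Nat.clog 2 T) (k - 1) ∪
      (overEvent ε α m T c k ∩ overEvent ε α m T c (k - 1)) := by
  have hk' := (Nat.pow_le_pow_right two_pos (Nat.sub_le k 1)).trans_lt hk
  rw [Set.union_inter_distrib_left]
  exact Set.subset_inter
    ((tableEvent_subset_underUnion_union_overEvent hε hα hargmax hm hoc hk).trans
      (Set.union_subset_union_left _ (underUnion_anti hε hα m o _ (Nat.sub_le k 1))))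
    (tableEvent_subset_underUnion_union_overEvent hε hα hargmax hm hoc hk')

end UnderUnion

/-! ### Probability that the index of a suboptimal arm is too large -/

section Complexity

theorem klReal_pos {p q : ℝ} (hp : 0 ≤ p) (hpq : p < q) (hq1 : q < 1) : 0 < klReal p q := by
  have hp1 : 0 < 1 - p := by linarith
  have hlog : Real.log ((1 - q) / (1 - p)) < (1 - q) / (1 - p) - 1 :=
    Real.log_lt_sub_one_of_pos (div_pos (sub_pos.2 hq1) hp1) ((div_lt_one hp1).2 (by linarith)).ne
  have hright : q - p < (1 - p) * Real.log ((1 - p) / (1 - q)) := by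
    rw [← inv_div, Real.log_inv]
    calc q - p = -((1 - p) * ((1 - q) / (1 - p) - 1)) := by field_simp; ring
      _ < -((1 - p) * Real.log ((1 - q) / (1 - p))) := neg_lt_neg (by gcongr)
      _ = (1 - p) * -Real.log ((1 - q) / (1 - p)) := by ring
  rw [klReal]
  linarith [sub_le_mul_log_div hp (hp.trans_lt hpq)]

theorem klBer_pos {p q : ℝ} (hp : 0 ≤ p) (hpq : p < q) (hq1 : q ≤ 1) : 0 < klBer p q := by
  rcases hq1.eq_or_lt with rfl | hq1
  · rw [klBer_one hpq.ne]
    exact EReal.zero_lt_top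
  · rw [klBer_eq_klReal p (hp.trans_lt hpq).ne' hq1.ne]
    exact_mod_cast klReal_pos hp hpq hq1

/-- The denominator of the regret bound for an arm of mean `q`, where `m` is the largest mean. The
minimum is finite, so no junk value arises from `EReal.toReal`. -/
def complexity (ε q m : ℝ) : ℝ := (min (klBer q m) ((6 * ε * (m - q) : ℝ) : EReal)).toReal

variable {ε q m : ℝ}

theorem coe_complexity (hε : 0 < ε) (hq : 0 ≤ q) (hqm : q < m) (hm : m ≤ 1) :
    (complexity ε q m : EReal) = min (klBer q m) ((6 * ε * (m - q) : ℝ) : EReal) := by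
  have hnoise : 0 < 6 * ε * (m - q) := mul_pos (by positivity) (sub_pos.2 hqm)
  refine EReal.coe_toReal (ne_top_of_le_ne_top (EReal.coe_ne_top _) (min_le_right _ _)) ?_
  exact (bot_lt_of_lt (lt_min (klBer_pos hq hqm hm) (EReal.coe_pos.2 hnoise))).ne'

theorem complexity_pos (hε : 0 < ε) (hq : 0 ≤ q) (hqm : q < m) (hm : m ≤ 1) :
    0 < complexity ε q m := by
  rw [← EReal.coe_pos, coe_complexity hε hq hqm hm]
  exact lt_min (klBer_pos hq hqm hm)
    (EReal.coe_pos.2 (mul_pos (by positivity) (sub_pos.2 hqm)))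

theorem complexity_le_mul (hε : 0 < ε) (hq : 0 ≤ q) (hqm : q < m) (hm : m ≤ 1) :
    complexity ε q m ≤ 6 * ε * (m - q) := by
  rw [← EReal.coe_le_coe_iff, coe_complexity hε hq hqm hm]
  exact min_le_right _ _

theorem coe_complexity_le_klBer (hε : 0 < ε) (hq : 0 ≤ q) (hqm : q < m) (hm : m ≤ 1) :
    (complexity ε q m : EReal) ≤ klBer q m := by
  rw [coe_complexity hε hq hqm hm]
  exact min_le_left _ _

theorem complexity_le_klReal (hε : 0 < ε) (hq : 0 ≤ q) (hqm : q < m) (hm : m < 1) :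
    complexity ε q m ≤ klReal q m := by
  rw [← EReal.coe_le_coe_iff, ← klBer_eq_klReal q (hq.trans_lt hqm).ne' hm.ne]
  exact coe_complexity_le_klBer hε hq hqm hm.le

/-- Lower bound for the rate at which the probability decays that the empirical mean of an arm of
mean `q` exceeds `q + (m - q) / 4`. -/
def quarterRate (q m : ℝ) : ℝ := ((m - q) / 4) ^ 2 / (4 * ((q + (m - q) / 4) * (1 - q)))

theorem quarterRate_pos (hq : 0 ≤ q) (hqm : q < m) (hm : m ≤ 1) : 0 < quarterRate q m := by
  exact div_pos (pow_pos (by linarith) 2)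
    (mul_pos four_pos (mul_pos (by linarith) (by linarith)))

theorem sq_div_le_quarterRate (hq : 0 ≤ q) (hqm : q < m) (hm : m ≤ 1) :
    (m - q) ^ 2 / (64 * (m * (1 - q))) ≤ quarterRate q m := by
  have hone : 0 < 1 - q := by linarith
  calc (m - q) ^ 2 / (64 * (m * (1 - q))) = ((m - q) / 4) ^ 2 / (4 * (m * (1 - q))) := by
        have : m ≠ 0 := (hq.trans_lt hqm).ne'
        field_simp
        norm_num
    _ ≤ quarterRate q m :=
        div_le_div_of_nonneg_left (sq_nonneg _)
          (mul_pos four_pos (mul_pos (by linarith) hone))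
          (mul_le_mul_of_nonneg_left (mul_le_mul_of_nonneg_right (by linarith) hone.le)
            zero_le_four)

theorem klReal_le_mul_quarterRate (hq : 0 ≤ q) (hqm : q < m) (hm : m < 1)
    (h : 1 - q ≤ 2 * (1 - m)) : klReal q m ≤ 128 * quarterRate q m := by
  have hm0 : 0 < m := hq.trans_lt hqm
  have hone : 0 < 1 - q := by linarith
  calc klReal q m ≤ (m - q) ^ 2 / (m * (1 - m)) := klReal_le_sq_div hq (hqm.trans hm).le hm0 hm
    _ ≤ (m - q) ^ 2 / (m * ((1 - q) / 2)) := by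
        gcongr
        linarith
    _ = 128 * ((m - q) ^ 2 / (64 * (m * (1 - q)))) := by
        field_simp
        ring
    _ ≤ 128 * quarterRate q m := by
        gcongr
        exact sq_div_le_quarterRate hq hqm hm.le

theorem one_sub_le_mul_quarterRate (hq : 0 ≤ q) (hqm : q < m) (hm : m ≤ 1)
    (h : 2 * (1 - m) ≤ 1 - q) : 1 - q ≤ 256 * quarterRate q m := by
  have hm0 : 0 < m := hq.trans_lt hqm
  have hone : 0 < 1 - q := by linarith
  have hle : (1 - q) / 256 ≤ (m - q) ^ 2 / (64 * (m * (1 - q))) := by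
    rw [div_le_div_iff₀ (by norm_num) (by positivity)]
    have hsq : (1 - q) ^ 2 ≤ 4 * (m - q) ^ 2 := by nlinarith
    nlinarith [mul_nonneg (sq_nonneg (1 - q)) (sub_nonneg.2 hm)]
  linarith [sq_div_le_quarterRate hq hqm hm]

theorem complexity_le_mul_quarterRate (hε : 0 < ε) (hq : 0 ≤ q) (hqm : q < m) (hm : m ≤ 1)
    {x : ℝ} (hx : 1 ≤ x) (h : complexity ε q m ≤ 96 * x * (1 - q)) :
    complexity ε q m ≤ 24576 * x * quarterRate q m := by
  have hrate := quarterRate_pos hq hqm hm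
  rcases le_total (1 - q) (2 * (1 - m)) with hle | hle
  · have hm1 : m < 1 := by linarith
    have hkl := (complexity_le_klReal hε hq hqm hm1).trans
      (klReal_le_mul_quarterRate hq hqm hm1 hle)
    nlinarith
  · have hone := one_sub_le_mul_quarterRate hq hqm hm hle
    nlinarith

end Complexity

section OverEvent

variable {K : ℕ} {ε α q m : ℝ} {T k : ℕ}

theorem exists_of_mem_overEvent (hε : 0 < ε) (hα : 0 ≤ α) (hm : m ≤ 1) {c : Fin K}
    {ω : (Fin K × ℕ → ℝ) × (Fin K × ℕ → Bool)} (hω : ω ∈ overEvent ε α m T c k) :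
    ∃ p ∈ Set.Icc (0 : ℝ) 1,
      (0 < p → p ≤ episodeMean ω.2 c k + ω.1 (c, k) + 2 * α * Real.log T / (ε * 2 ^ k)) ∧
      (m ≤ p ∨ klBer p m ≤ ((2 * α * Real.log T / 2 ^ k : ℝ) : EReal)) := by
  obtain ⟨n, hn, hnT, hindex⟩ := hω
  have hlog0 : 0 ≤ Real.log n := Real.log_natCast_nonneg n
  have hlog : Real.log n ≤ Real.log T :=
    Real.log_le_log (by exact_mod_cast hn) (by exact_mod_cast hnT)
  have hbonus : α * Real.log n / (ε * (1 / 2 * (2 ^ k : ℕ))) ≤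
      2 * α * Real.log T / (ε * 2 ^ k) := by
    calc α * Real.log n / (ε * (1 / 2 * (2 ^ k : ℕ))) = 2 * α * Real.log n / (ε * 2 ^ k) := by
          push_cast
          field_simp
      _ ≤ 2 * α * Real.log T / (ε * 2 ^ k) := by gcongr
  have hradius : α * Real.log n / (1 / 2 * (2 ^ k : ℕ)) ≤ 2 * α * Real.log T / 2 ^ k := by
    calc α * Real.log n / (1 / 2 * (2 ^ k : ℕ)) = 2 * α * Real.log n / 2 ^ k := by
          push_cast
          field_simp
      _ ≤ 2 * α * Real.log T / 2 ^ k := by gcongr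
  rw [klIndex_eq_klUpper] at hindex
  refine ⟨_, clip_mem _, fun hpos => ?_, (klBer_le_of_le_klUpper (clip_mem _) (by positivity) hm
    hindex).imp_right fun hkl => hkl.trans (by exact_mod_cast hradius)⟩
  refine (clip_le_of_nonneg ?_).trans (add_le_add_right hbonus _)
  by_contra! hneg
  rw [clip, max_eq_left hneg.le, min_eq_left zero_le_one] at hpos
  exact lt_irrefl _ hpos

theorem midpoint_lt_of_klBer_le (hε : 0 < ε) (hq : 0 ≤ q) (hqm : q < m) (hm : m ≤ 1) {p b : ℝ}
    (hp : 0 ≤ p) (hb : 12 * b < complexity ε q m) (h : m ≤ p ∨ klBer p m ≤ (b : EReal)) :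
    (q + m) / 2 < p := by
  by_contra! hle
  have hkl := (klBer_anti_left hp hle (by linarith) hm).trans (h.resolve_left (by linarith))
  rcases hm.eq_or_lt with rfl | hm1
  · rw [klBer_one (by linarith)] at hkl
    exact hkl.not_gt (EReal.coe_lt_top b)
  · rw [klBer_eq_klReal _ (hq.trans_lt hqm).ne' hm1.ne, EReal.coe_le_coe_iff] at hkl
    linarith [klReal_le_klReal_midpoint hq hqm hm1, complexity_le_klReal hε hq hqm hm1]

theorem overEvent_subset_of_le (hε : 0 < ε) (hα : 0 ≤ α) (hq : 0 ≤ q) (hqm : q < m)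
    (hm : m ≤ 1) (hk : 96 * α * Real.log T ≤ complexity ε q m * 2 ^ k) (c : Fin K) :
    overEvent ε α m T c k ⊆ {ω | (m - q) / 8 < ω.1 (c, k)} ∪
      {ω | q + (m - q) / 4 ≤ episodeMean ω.2 c k} := by
  intro ω hω
  obtain ⟨p, hp, hp_le, hkl⟩ := exists_of_mem_overEvent hε hα hm hω
  have hpow : (0 : ℝ) < 2 ^ k := by positivity
  have hradius : 2 * α * Real.log T / 2 ^ k ≤ complexity ε q m / 48 := by
    rw [div_le_div_iff₀ hpow (by norm_num)]
    linarith
  have hbonus : 2 * α * Real.log T / (ε * 2 ^ k) ≤ (m - q) / 8 := by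
    have hD := mul_le_mul_of_nonneg_right (complexity_le_mul hε hq hqm hm) hpow.le
    rw [div_le_div_iff₀ (by positivity) (by norm_num)]
    linarith
  have hmid := midpoint_lt_of_klBer_le hε hq hqm hm hp.1
    (by linarith [complexity_pos hε hq hqm hm]) hkl
  have hsum := hp_le (by linarith)
  by_contra hnot
  simp only [Set.mem_union, Set.mem_ofPred_eq, not_or, not_lt, not_le] at hnot
  linarith [hnot.1, hnot.2]

variable {μ : Fin K → unitInterval}

theorem tableLaw_real_noise_gt (hε : 0 < ε) (c : Fin K) (k : ℕ) {s : ℝ} (hs : 0 ≤ s) :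
    (tableLaw ε μ).real {ω | s < ω.1 (c, k)} = Real.exp (-(s * (ε * 2 ^ k / 2))) / 2 := by
  rw [← noiseLaw_real_gt hε (c, k) hs]
  exact tableLaw_real_fst ε μ {Z | s < Z (c, k)}

theorem tableLaw_real_episodeMean_ge (hε : 0 < ε) (c : Fin K) (k : ℕ) {r : ℝ} (hr : μ c < r)
    (hr1 : r < 1) :
    (tableLaw ε μ).real {ω | r ≤ episodeMean ω.2 c k} ≤
      Real.exp (-(2 ^ k * ((r - μ c) ^ 2 / (4 * (r * (1 - μ c))) / 2))) := by
  refine (tableLaw_real_snd hε μ {X | r ≤ episodeMean X c k}).trans_le ?_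
  have hcard : (0 : ℝ) < (episodeEntries c k).card := by
    rw [card_episodeEntries]
    exact card_episode_pos k
  simp only [episodeMean_eq, le_div_iff₀' hcard]
  refine (bernoulliPi_real_le_sum (μ := fun i : Fin K × ℕ => μ i.1)
    (fun i hi => congrArg μ (fst_eq_of_mem_episodeEntries hi)) hr hr1).trans ?_
  have hrate : 0 ≤ (r - μ c) ^ 2 / (4 * (r * (1 - μ c))) :=
    div_nonneg (sq_nonneg _) (mul_nonneg zero_le_four
      (mul_nonneg ((μ c).2.1.trans hr.le) (sub_nonneg.2 (μ c).2.2)))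
  refine Real.exp_le_exp.2 (neg_le_neg ?_)
  rw [card_episodeEntries, mul_div_assoc', mul_div_right_comm]
  exact mul_le_mul_of_nonneg_right (half_two_pow_le_card_episode k) hrate

theorem tableLaw_real_overEvent_le (hε : 0 < ε) (hα : 0 ≤ α) {m : ℝ} (hm : m ≤ 1) {c : Fin K}
    (hcm : μ c < m) (T k : ℕ) :
    (tableLaw ε μ).real (overEvent ε α m T c k) ≤
      (if (2 : ℝ) ^ k < 96 * α * Real.log T / complexity ε (μ c) m then 1 else 0) +
        1 / 2 * Real.exp (-(2 ^ k * (ε * (m - μ c) / 16))) +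
          Real.exp (-(2 ^ k * (quarterRate (μ c) m / 2))) := by
  have := isProbabilityMeasure_tableLaw hε μ
  have hnoise := Real.exp_pos (-(2 ^ k * (ε * (m - μ c) / 16)))
  have hrate := Real.exp_pos (-(2 ^ k * (quarterRate (μ c) m / 2)))
  split_ifs with hk
  · have : (tableLaw ε μ).real (overEvent ε α m T c k) ≤ 1 := measureReal_le_one
    linarith
  · rw [not_lt, div_le_iff₀' (complexity_pos hε (μ c).2.1 hcm hm)] at hk
    have hmean := tableLaw_real_episodeMean_ge hε c k (μ := μ) (r := μ c + (m - μ c) / 4)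
      (by linarith) (by linarith)
    rw [add_sub_cancel_left] at hmean
    refine (measureReal_mono (overEvent_subset_of_le hε hα (μ c).2.1 hcm hm hk c)).trans
      ((measureReal_union_le _ _).trans ?_)
    rw [tableLaw_real_noise_gt hε c k (by linarith), zero_add, one_div_mul_eq_div,
      show (m - μ c) / 8 * (ε * 2 ^ k / 2) = 2 ^ k * (ε * (m - μ c) / 16) by ring]
    exact add_le_add_right hmean _

theorem sum_two_pow_mul_tableLaw_real_overEvent_le (hε : 0 < ε) (hα : 0 ≤ α) {m : ℝ} (hm : m ≤ 1)
    {c : Fin K} (hcm : μ c < m) (T n : ℕ) :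
    ∑ k ∈ Finset.range n, 2 ^ k * (tableLaw ε μ).real (overEvent ε α m T c k) ≤
      2 * (96 * α * Real.log T / complexity ε (μ c) m) + 16 / (ε * (m - μ c)) +
        4 / quarterRate (μ c) m := by
  have hD := complexity_pos hε (μ c).2.1 hcm hm
  have hN : 0 ≤ 96 * α * Real.log T / complexity ε (μ c) m :=
    div_nonneg (mul_nonneg (by positivity) (Real.log_natCast_nonneg T)) hD.le
  have hz : 0 < ε * (m - μ c) / 16 := div_pos (mul_pos hε (sub_pos.2 hcm)) (by norm_num)
  have hrate := quarterRate_pos (μ c).2.1 hcm hm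
  refine (Finset.sum_le_sum fun k _ => mul_le_mul_of_nonneg_left
    (tableLaw_real_overEvent_le hε hα hm hcm T k) (pow_nonneg zero_le_two k)).trans ?_
  simp only [mul_add, mul_ite, mul_one, mul_zero, mul_left_comm _ (1 / 2 : ℝ),
    Finset.sum_add_distrib, ← Finset.mul_sum]
  have hnoise := sum_two_pow_mul_exp_le hz n
  have hmean := sum_two_pow_mul_exp_le (half_pos hrate) n
  have hnoise_eq : 2 / (ε * (m - μ c) / 16) = 2 * (16 / (ε * (m - μ c))) := by
    rw [div_div_eq_mul_div, mul_div_assoc]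
  linarith [sum_two_pow_filter_le hN n]

end OverEvent

section HardArms

variable {K : ℕ} {ε α : ℝ} {μ : Fin K → unitInterval} {sel : (Fin K → ℝ) → Fin K} {T : ℕ}

theorem half_le_log {T : ℕ} (hT : 2 ≤ T) : 1 / 2 ≤ Real.log T := by
  have hlog : Real.log 2 ≤ Real.log T := Real.log_le_log two_pos (by exact_mod_cast hT)
  linarith [Real.log_two_gt_d9]

theorem historyExp_pulls_le_of_complexity_le (hε : 0 < ε) (hα : 3 ≤ α) (hsel : IsArgmaxRule sel)
    {o c : Fin K} (hoc : μ c < μ o) (hT : 2 ≤ T)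
    (hcase : complexity ε (μ c) (μ o) ≤ 96 * (α * Real.log T) * (1 - μ c)) :
    historyExp (adaPKLUCB K ε α sel T) (fun c => μ c)
        (fun a _ => (Finset.univ.filter fun t => a t = c).card) ≤
      17 / 9 + 100000 * (α * Real.log T) / complexity ε (μ c) (μ o) := by
  have := isProbabilityMeasure_tableLaw hε μ
  have hα0 : 0 ≤ α := by linarith
  have hoc' : (μ c : ℝ) < μ o := hoc
  have hD := complexity_pos hε (μ c).2.1 hoc' (μ o).2.2
  have hx : 3 / 2 ≤ α * Real.log T := by nlinarith [half_le_log hT]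
  have hnoise : 16 / (ε * (μ o - μ c)) ≤ 96 / complexity ε (μ c) (μ o) := by
    rw [div_le_div_iff₀ (mul_pos hε (sub_pos.2 hoc')) hD]
    linarith [complexity_le_mul hε (μ c).2.1 hoc' (μ o).2.2]
  have hmean : 4 / quarterRate (μ c) (μ o) ≤
      98304 * (α * Real.log T) / complexity ε (μ c) (μ o) := by
    rw [div_le_div_iff₀ (quarterRate_pos (μ c).2.1 hoc' (μ o).2.2) hD]
    linarith [complexity_le_mul_quarterRate hε (μ c).2.1 hoc' (μ o).2.2 (by linarith) hcase]
  refine (historyExp_pulls_le hε hsel.1 T c _ fun k a b hk =>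
    tableEvent_subset_underUnion_union_overEvent (o := o) hε hα0 hsel.2 (μ o).2
      (fun h => hoc.ne' (congrArg μ h)) hk).trans ?_
  calc 1 + ∑ k ∈ Finset.range (Nat.clog 2 T), 2 ^ k * (tableLaw ε μ).real
        (underUnion ε α (μ o) o (Nat.clog 2 T) k ∪ overEvent ε α (μ o) T c k)
      ≤ 1 + ∑ k ∈ Finset.range (Nat.clog 2 T), (2 ^ k * (4 / 9 / ((2 : ℝ) ^ k + 1) ^ 2) +
          2 ^ k * (tableLaw ε μ).real (overEvent ε α (μ o) T c k)) := by
        gcongr with k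
        rw [← mul_add]
        gcongr
        exact (measureReal_union_le _ _).trans
          (add_le_add_left (tableLaw_real_underUnion_le hε hα μ o _ k) _)
    _ ≤ 14 / 9 + (2 * (96 * α * Real.log T / complexity ε (μ c) (μ o)) +
          96 / complexity ε (μ c) (μ o) +
            98304 * (α * Real.log T) / complexity ε (μ c) (μ o)) := by
        rw [Finset.sum_add_distrib]
        linarith [sum_two_pow_div_sq_le (Nat.clog 2 T),
          sum_two_pow_mul_tableLaw_real_overEvent_le hε hα0 (μ o).2.2 hoc' T (Nat.clog 2 T)]
    _ = 14 / 9 + (98496 * (α * Real.log T) + 96) / complexity ε (μ c) (μ o) := by ring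
    _ ≤ 17 / 9 + 100000 * (α * Real.log T) / complexity ε (μ c) (μ o) := by
        gcongr <;> linarith

end HardArms

/-! ### Arms of large complexity -/

section EasyArms

variable {ε q m : ℝ}

theorem log_one_sub_lt_of_lt_klReal (hq : 0 ≤ q) (hqm : q < m) (hm : m < 1) {x : ℝ}
    (h : (1 - q) * x < klReal q m) : Real.log (1 - m) < -x := by
  have hq1 : 0 < 1 - q := by linarith
  have hlt : x < Real.log ((1 - q) / (1 - m)) :=
    lt_of_mul_lt_mul_left (h.trans_le (klReal_le_mul_log hq hqm.le)) hq1.le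
  rw [Real.log_div hq1.ne' (sub_pos.2 hm).ne'] at hlt
  linarith [Real.log_nonpos hq1.le (by linarith)]

theorem one_sub_mul_le_klReal {p : ℝ} (hp : 0 ≤ p) (hp1 : p < 1) (hm : 0 < m) (hm1 : m < 1) :
    (1 - p) * (Real.log (1 - p) - Real.log (1 - m) - 1) ≤ klReal p m := by
  rw [klReal, Real.log_div (sub_pos.2 hp1).ne' (sub_pos.2 hm1).ne']
  linarith [sub_le_mul_log_div hp hm]

theorem one_sub_le_of_lt_complexity (hε : 0 < ε) (hq : 0 ≤ q) (hqm : q < m) (hm : m ≤ 1)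
    {p x N : ℝ} (hp : 0 ≤ p) (hN : 0 < N) (hx : 1 ≤ x) (hNx : Real.log N ≤ x)
    (hcase : 96 * x * (1 - q) < complexity ε q m)
    (h : m ≤ p ∨ klBer p m ≤ ((8 * x / N : ℝ) : EReal)) : 1 - p ≤ 1 / N := by
  by_contra! hlt
  have hp1 : 0 < 1 - p := (one_div_pos.2 hN).trans hlt
  rcases hm.eq_or_lt with rfl | hm1
  · have hkl := h.resolve_left (by linarith)
    rw [klBer_one (by linarith)] at hkl
    exact hkl.not_gt (EReal.coe_lt_top _)
  have hm0 : 0 < m := hq.trans_lt hqm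
  have hlogm : Real.log (1 - m) < -(96 * x) :=
    log_one_sub_lt_of_lt_klReal hq hqm hm1 (by linarith [complexity_le_klReal hε hq hqm hm1])
  have hlogp : -x ≤ Real.log (1 - p) := by
    have hlog := Real.log_le_log (one_div_pos.2 hN) hlt.le
    rw [one_div, Real.log_inv] at hlog
    linarith
  have hkl := h.resolve_left fun hmp => by
    linarith [Real.log_le_log hp1 (sub_le_sub_left hmp 1)]
  rw [klBer_eq_klReal p hm0.ne' hm1.ne, EReal.coe_le_coe_iff] at hkl
  refine lt_irrefl (8 * x / N) ?_
  calc 8 * x / N = 1 / N * (8 * x) := (one_div_mul_eq_div _ _).symm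
    _ < (1 - p) * (8 * x) := mul_lt_mul_of_pos_right hlt (by linarith)
    _ ≤ (1 - p) * (Real.log (1 - p) - Real.log (1 - m) - 1) :=
        mul_le_mul_of_nonneg_left (by linarith) hp1.le
    _ ≤ klReal p m := one_sub_mul_le_klReal hp (by linarith) hm0 hm1
    _ ≤ 8 * x / N := hkl

theorem sixteen_mul_lt_of_lt_complexity (hε : 0 < ε) (hq : 0 ≤ q) (hqm : q < m) (hm : m ≤ 1)
    {x : ℝ} (hcase : 96 * x * (1 - q) < complexity ε q m) : 16 * x < ε := by
  refine lt_of_mul_lt_mul_right (a := 1 - q) ?_ (by linarith)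
  linarith [complexity_le_mul hε hq hqm hm, mul_le_mul_of_nonneg_left hm hε.le]

variable {K : ℕ} {α : ℝ} {T k : ℕ}

theorem card_episode_le (k : ℕ) : ((episode k).card : ℝ) ≤ 2 ^ k := by
  rw [card_episode]
  push_cast
  exact sub_le_self _ (Nat.cast_nonneg _)

theorem forall_eq_true_of_lt_episodeMean {X : Fin K × ℕ → Bool} {c : Fin K}
    (h : 1 - 1 / 2 ^ k < episodeMean X c k) : ∀ i ∈ episodeEntries c k, X i = true := by
  intro i hi
  by_contra hne
  have hcard := card_episode_pos k
  have hcard_le := card_episode_le k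
  rw [← card_episodeEntries c k] at hcard hcard_le
  have hsum : ∑ j ∈ episodeEntries c k, rewardValue (X j) ≤ (episodeEntries c k).card - 1 := by
    classical
    have hrest := (sum_rewardValue_mem X ((episodeEntries c k).erase i)).2
    rw [Finset.card_erase_of_mem hi, Nat.cast_sub (Finset.card_pos.2 ⟨i, hi⟩)] at hrest
    rw [← Finset.add_sum_erase _ _ hi, Bool.eq_false_of_not_eq_true hne]
    simpa [rewardValue] using hrest
  rw [episodeMean_eq, lt_div_iff₀ hcard] at h
  have hdiv : 1 / 2 ^ k * ((episodeEntries c k).card : ℝ) ≤ 1 := by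
    rw [one_div_mul_eq_div]
    exact div_le_one_of_le₀ hcard_le (by positivity)
  linarith

theorem overEvent_subset_of_lt (hε : 0 < ε) (hα : 3 ≤ α) (hq : 0 ≤ q) (hqm : q < m) (hm : m ≤ 1)
    (hcase : 96 * (α * Real.log T) * (1 - q) < complexity ε q m) (hT : 2 ≤ T) (hk : 2 ^ k < T)
    (c : Fin K) :
    overEvent ε α m T c k ⊆ {ω | 1 / (4 * 2 ^ k) < ω.1 (c, k)} ∪
      {ω | ∀ i ∈ episodeEntries c k, ω.2 i = true} := by
  intro ω hω
  obtain ⟨p, hp, hp_le, hkl⟩ := exists_of_mem_overEvent hε (by linarith) hm hω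
  have hhalf := half_le_log hT
  have hx : 1 ≤ α * Real.log T := by nlinarith
  have hlog : Real.log (4 * 2 ^ k) ≤ α * Real.log T := by
    have hT' : (2 : ℝ) ≤ T := by exact_mod_cast hT
    have hk' : (2 : ℝ) ^ k ≤ T := by exact_mod_cast hk.le
    have hle : 4 * 2 ^ k ≤ (T : ℝ) ^ 3 := by
      rw [pow_succ]
      exact mul_le_mul (by nlinarith) hk' (by positivity) (sq_nonneg _)
    calc Real.log (4 * 2 ^ k) ≤ Real.log ((T : ℝ) ^ 3) := Real.log_le_log (by positivity) hle
      _ = 3 * Real.log T := by rw [Real.log_pow, Nat.cast_ofNat]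
      _ ≤ α * Real.log T := mul_le_mul_of_nonneg_right hα (by linarith)
  have hradius : 2 * α * Real.log T / 2 ^ k = 8 * (α * Real.log T) / (4 * 2 ^ k) := by
    field_simp
    norm_num
  rw [hradius] at hkl
  have hp_ge := one_sub_le_of_lt_complexity hε hq hqm hm hp.1 (by positivity) hx hlog hcase hkl
  have hquarter : 1 / (4 * (2 : ℝ) ^ k) = 1 / 2 ^ k / 4 := by rw [mul_comm, div_div]
  have hbonus : 2 * α * Real.log T / (ε * 2 ^ k) ≤ 1 / 2 ^ k / 8 := by
    rw [div_div, div_le_div_iff₀ (by positivity) (by positivity)]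
    nlinarith [sixteen_mul_lt_of_lt_complexity hε hq hqm hm hcase, pow_pos (two_pos (α := ℝ)) k]
  have hinv_pos : 0 < 1 / (2 : ℝ) ^ k := by positivity
  have hinv_le : 1 / (2 : ℝ) ^ k ≤ 1 := div_le_one_of_le₀ (one_le_pow₀ one_le_two) (by positivity)
  rw [hquarter] at hp_ge
  have hsum := hp_le (by linarith)
  refine or_iff_not_imp_left.2 fun hnoise => forall_eq_true_of_lt_episodeMean ?_
  rw [Set.mem_ofPred_eq, not_lt, hquarter] at hnoise
  linarith

theorem card_episodeEntries_union_pred (c : Fin K) (k : ℕ) :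
    (episodeEntries c k ∪ episodeEntries c (k - 1)).card = lastTwo k := by
  rw [episodeEntries, episodeEntries, ← Finset.product_union, Finset.card_product,
    Finset.card_singleton, one_mul]
  match k with
  | 0 => simp [episode, lastTwo]
  | 1 => decide
  | k + 2 =>
    rw [lastTwo, episode, episode, show k + 2 - 1 = k + 1 by omega, pow_succ 2 (k + 1),
      pow_succ 2 k, Nat.mul_div_cancel _ two_pos, Nat.mul_div_cancel _ two_pos, Finset.union_comm,
      Finset.Ico_union_Ico_eq_Ico (by omega) (by omega), Nat.card_Ico]
    omega

variable {μ : Fin K → unitInterval}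

theorem tableLaw_real_forall_eq_true (hε : 0 < ε) (c : Fin K) (k : ℕ) :
    (tableLaw ε μ).real {ω | ∀ i ∈ episodeEntries c k ∪ episodeEntries c (k - 1), ω.2 i = true} =
      μ c ^ lastTwo k := by
  refine (tableLaw_real_snd hε μ
    {X | ∀ i ∈ episodeEntries c k ∪ episodeEntries c (k - 1), X i = true}).trans ?_
  rw [bernoulliPi_real_forall_eq (fun i : Fin K × ℕ => μ i.1) _ fun _ => true,
    ← card_episodeEntries_union_pred c k]
  refine Finset.prod_eq_pow_card fun i hi => ?_
  rw [(Finset.mem_union.1 hi).elim fst_eq_of_mem_episodeEntries fst_eq_of_mem_episodeEntries,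
    bernoulliMass]
  exact if_pos rfl

theorem tableLaw_real_noise_gt_le (hε : 0 < ε) (hα : 3 ≤ α) (hT : 0 < T)
    (hαT : 16 * (α * Real.log T) < ε) (c : Fin K) (k : ℕ) :
    (tableLaw ε μ).real {ω | 1 / (4 * 2 ^ k) < ω.1 (c, k)} ≤ 1 / T ^ 6 / 2 := by
  rw [tableLaw_real_noise_gt hε c k (by positivity),
    show 1 / (4 * 2 ^ k) * (ε * 2 ^ k / 2) = ε / 8 by field_simp; norm_num]
  refine div_le_div_of_nonneg_right ?_ zero_le_two
  calc Real.exp (-(ε / 8)) ≤ Real.exp (-(2 * α * Real.log T)) := Real.exp_le_exp.2 (by linarith)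
    _ ≤ 1 / (T : ℝ) ^ 6 := exp_neg_mul_log_le hT (by push_cast; linarith)

theorem tableLaw_real_inter_overEvent_le (hε : 0 < ε) (hα : 3 ≤ α) (hm : m ≤ 1) {c : Fin K}
    (hcm : μ c < m) (hT : 2 ≤ T)
    (hcase : 96 * (α * Real.log T) * (1 - μ c) < complexity ε (μ c) m) (hk : 2 ^ k < T) :
    (tableLaw ε μ).real (overEvent ε α m T c k ∩ overEvent ε α m T c (k - 1)) ≤
      μ c ^ lastTwo k + 1 / T ^ 6 := by
  have := isProbabilityMeasure_tableLaw hε μ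
  have hk' : 2 ^ (k - 1) < T := (Nat.pow_le_pow_right two_pos (Nat.sub_le k 1)).trans_lt hk
  set noisy : ℕ → Set ((Fin K × ℕ → ℝ) × (Fin K × ℕ → Bool)) :=
    fun k => {ω | 1 / (4 * 2 ^ k) < ω.1 (c, k)}
  have hsub : overEvent ε α m T c k ∩ overEvent ε α m T c (k - 1) ⊆
      {ω | ∀ i ∈ episodeEntries c k ∪ episodeEntries c (k - 1), ω.2 i = true} ∪
        (noisy k ∪ noisy (k - 1)) := by
    rintro ω ⟨hlast, hprev⟩
    rcases overEvent_subset_of_lt hε hα (μ c).2.1 hcm hm hcase hT hk c hlast with hlast | hlast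
    · exact Or.inr (Or.inl hlast)
    rcases overEvent_subset_of_lt hε hα (μ c).2.1 hcm hm hcase hT hk' c hprev with hprev | hprev
    · exact Or.inr (Or.inr hprev)
    · exact Or.inl fun i hi => (Finset.mem_union.1 hi).elim (hlast i) (hprev i)
  have hnoise := tableLaw_real_noise_gt_le (μ := μ) hε hα (by omega)
    (sixteen_mul_lt_of_lt_complexity hε (μ c).2.1 hcm hm hcase) c
  calc (tableLaw ε μ).real (overEvent ε α m T c k ∩ overEvent ε α m T c (k - 1))
      ≤ μ c ^ lastTwo k + (tableLaw ε μ).real (noisy k ∪ noisy (k - 1)) := by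
        rw [← tableLaw_real_forall_eq_true hε]
        exact (measureReal_mono hsub).trans (measureReal_union_le _ _)
    _ ≤ μ c ^ lastTwo k + 1 / T ^ 6 := by
        linarith [measureReal_union_le (μ := tableLaw ε μ) (noisy k) (noisy (k - 1)),
          hnoise k, hnoise (k - 1)]

theorem sum_two_pow_div_pow_six_le (hT : 2 ≤ T) :
    ∑ k ∈ Finset.range (Nat.clog 2 T), (2 : ℝ) ^ k * (1 / T ^ 6) ≤ 1 / 16 := by
  have hT' : (2 : ℝ) ≤ T := by exact_mod_cast hT
  rw [← Finset.sum_mul]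
  calc (∑ k ∈ Finset.range (Nat.clog 2 T), (2 : ℝ) ^ k) * (1 / T ^ 6) ≤ 2 * T * (1 / T ^ 6) :=
        mul_le_mul_of_nonneg_right (sum_two_pow_clog_le T) (by positivity)
    _ = 2 / T ^ 5 := by field_simp
    _ ≤ 2 / 2 ^ 5 := by gcongr
    _ = 1 / 16 := by norm_num

theorem one_sub_mul_add_le_three (hq : 0 ≤ q) (hq1 : q ≤ 1) :
    (1 - q) * (1 + 11 / 9 + 1 / 16) +
      ((1 - q) * (q + 2 * q ^ 2 + 4 * q ^ 3) + 8 / 3 * q ^ 3) ≤ 3 := by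
  nlinarith [mul_nonneg hq (sub_nonneg.2 hq1), sq_nonneg (q ^ 2 - q * (3 / 5)),
    sq_nonneg (q - 7 / 8), sq_nonneg (q * (q - 7 / 8)), sq_nonneg (q ^ 2 - 7 / 8 * q),
    mul_nonneg (mul_nonneg hq hq) (sub_nonneg.2 hq1)]

theorem one_sub_mul_historyExp_pulls_le {sel : (Fin K → ℝ) → Fin K} (hε : 0 < ε) (hα : 3 ≤ α)
    (hsel : IsArgmaxRule sel) {o c : Fin K} (hoc : μ c < μ o) (hT : 2 ≤ T)
    (hcase : 96 * (α * Real.log T) * (1 - μ c) < complexity ε (μ c) (μ o)) :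
    (1 - μ c) * historyExp (adaPKLUCB K ε α sel T) (fun c => μ c)
        (fun a _ => (Finset.univ.filter fun t => a t = c).card) ≤ 3 := by
  have := isProbabilityMeasure_tableLaw hε μ
  set n := Nat.clog 2 T
  set geometric : ℝ := ∑ k ∈ Finset.range n, 2 ^ k * (μ c : ℝ) ^ lastTwo k
  have hpulls : historyExp (adaPKLUCB K ε α sel T) (fun c => μ c)
      (fun a _ => (Finset.univ.filter fun t => a t = c).card) ≤
        1 + (11 / 9 + (geometric + 1 / 16)) := by
    refine (historyExp_pulls_le hε hsel.1 T c _ fun k a b hk =>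
      tableEvent_subset_underUnion_union_inter_overEvent (o := o) hε (by linarith) hsel.2 (μ o).2
        (fun h => hoc.ne' (congrArg μ h)) hk).trans (add_le_add_right ?_ 1)
    refine (Finset.sum_le_sum fun k hk => mul_le_mul_of_nonneg_left
      ((measureReal_union_le _ _).trans (add_le_add
        (tableLaw_real_underUnion_le hε hα μ o _ (k - 1))
        (tableLaw_real_inter_overEvent_le hε hα (μ o).2.2 hoc hT hcase
          ((Nat.lt_clog_iff_pow_lt one_lt_two).1 (Finset.mem_range.1 hk)))))
      (pow_nonneg zero_le_two k)).trans ?_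
    simp only [mul_add, Finset.sum_add_distrib]
    exact add_le_add (sum_two_pow_div_sq_pred_le n)
      (add_le_add_right (sum_two_pow_div_pow_six_le hT) geometric)
  have hgeometric := sum_two_pow_mul_pow_lastTwo_le (μ c).2.1 (μ c).2.2 n
  linarith [mul_le_mul_of_nonneg_left hpulls (sub_nonneg.2 (μ c).2.2),
    one_sub_mul_add_le_three (μ c).2.1 (μ c).2.2]

end EasyArms

/-! ### The regret bound -/

section Main

variable {K : ℕ} {ε α : ℝ} {μ : Fin K → unitInterval} {sel : (Fin K → ℝ) → Fin K}

theorem gap_nonneg (μ : Fin K → ℝ) (c : Fin K) : 0 ≤ gap μ c :=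
  sub_nonneg.2 (le_ciSup (Set.finite_range μ).bddAbove c)

theorem historyExp_pulls_le_one (hε : 0 < ε) (hsel : Measurable sel) (c : Fin K) {T : ℕ}
    (hT : T < 2) :
    historyExp (adaPKLUCB K ε α sel T) (fun c => μ c)
        (fun a _ => (Finset.univ.filter fun t => a t = c).card) ≤ 1 := by
  have hpulls := historyExp_pulls_le (α := α) (μ := μ) hε hsel T c (fun _ => Set.univ)
    fun _ _ _ _ => Set.subset_univ _
  rwa [Nat.clog_of_right_le_one (Nat.le_of_lt_succ hT), Finset.sum_range_zero, add_zero] at hpulls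

theorem sub_mul_historyExp_pulls_le (hε : 0 < ε) (hα : 3 ≤ α) (hsel : IsArgmaxRule sel)
    {o c : Fin K} (hoc : μ c < μ o) (T : ℕ) :
    (μ o - μ c) * historyExp (adaPKLUCB K ε α sel T) (fun c => μ c)
        (fun a _ => (Finset.univ.filter fun t => a t = c).card) ≤
      100000 * α * (μ o - μ c) / complexity ε (μ c) (μ o) * Real.log T + 3 := by
  set pulls := historyExp (adaPKLUCB K ε α sel T) (fun c => μ c)
    fun a _ => (Finset.univ.filter fun t => a t = c).card
  have hgap : 0 < (μ o - μ c : ℝ) := sub_pos.2 hoc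
  have hgap_le : (μ o - μ c : ℝ) ≤ 1 - μ c := sub_le_sub_right (μ o).2.2 _
  have hD := complexity_pos hε (μ c).2.1 hoc (μ o).2.2
  have hgap_one : (μ o - μ c : ℝ) ≤ 1 := hgap_le.trans (sub_le_self _ (μ c).2.1)
  have hmain : 0 ≤ 100000 * α * (μ o - μ c) / complexity ε (μ c) (μ o) * Real.log T :=
    mul_nonneg (div_nonneg (mul_nonneg (by linarith) hgap.le) hD.le) (Real.log_natCast_nonneg T)
  rcases lt_or_ge T 2 with hT | hT
  · have hpulls := mul_le_mul_of_nonneg_left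
      (historyExp_pulls_le_one (α := α) (μ := μ) hε hsel.1 c hT) hgap.le
    linarith
  rcases le_or_gt (complexity ε (μ c) (μ o)) (96 * (α * Real.log T) * (1 - μ c)) with hcase | hcase
  · calc (μ o - μ c) * pulls
        ≤ (μ o - μ c) * (17 / 9 + 100000 * (α * Real.log T) / complexity ε (μ c) (μ o)) :=
          mul_le_mul_of_nonneg_left
            (historyExp_pulls_le_of_complexity_le hε hα hsel hoc hT hcase) hgap.le
      _ = 100000 * α * (μ o - μ c) / complexity ε (μ c) (μ o) * Real.log T +
            17 / 9 * (μ o - μ c) := by ring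
      _ ≤ 100000 * α * (μ o - μ c) / complexity ε (μ c) (μ o) * Real.log T + 3 := by linarith
  · have hpulls_nonneg : 0 ≤ pulls := by
      simpa only [← Pi.zero_def, map_zero] using
        historyExp_mono (ε := ε) (α := α) (sel := sel) (μ := μ) (F := 0)
          (fun a _ => Nat.cast_nonneg (Finset.univ.filter fun t : Fin T => a t = c).card)
    linarith [mul_le_mul_of_nonneg_right hgap_le hpulls_nonneg,
      one_sub_mul_historyExp_pulls_le hε hα hsel hoc hT hcase]

theorem regret_adaPKLUCB_le (hε : 0 < ε) (hα : 3 ≤ α) (hsel : IsArgmaxRule sel)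
    (μ : Fin K → unitInterval) (T : ℕ) :
    regret (adaPKLUCB K ε α sel T) (fun c => μ c) ≤
      ∑ c with 0 < gap (fun c => (μ c : ℝ)) c,
        (100000 * α * gap (fun c => (μ c : ℝ)) c /
          complexity ε (μ c) (bestMean fun c => (μ c : ℝ)) * Real.log T + 3) := by
  rw [regret_eq_sum_gap hε hsel.1, Finset.sum_filter]
  refine Finset.sum_le_sum fun c _ => ?_
  split_ifs with hc
  · have : Nonempty (Fin K) := ⟨c⟩
    obtain ⟨o, ho⟩ : ∃ o, (μ o : ℝ) = bestMean fun c => (μ c : ℝ) := exists_eq_ciSup_of_finite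
    rw [gap, ← ho] at hc ⊢
    exact sub_mul_historyExp_pulls_le hε hα hsel (Subtype.coe_lt_coe.1 (sub_pos.1 hc)) T
  · rw [le_antisymm (not_lt.1 hc) (gap_nonneg _ c), zero_mul]

theorem limsup_div_log_le {f : ℕ → ℝ} {A B : ℝ} (h : ∀ T : ℕ, f T ≤ A * Real.log T + B) :
    Filter.limsup (fun T : ℕ => ((f T / Real.log T : ℝ) : EReal)) Filter.atTop ≤ (A : EReal) := by
  have hlog : Filter.Tendsto (fun T : ℕ => Real.log T) Filter.atTop Filter.atTop :=
    Real.tendsto_log_atTop.comp tendsto_natCast_atTop_atTop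
  have hlim : Filter.Tendsto (fun T : ℕ => ((A + B / Real.log T : ℝ) : EReal)) Filter.atTop
      (nhds (A : EReal)) := by
    refine (continuous_coe_real_ereal.tendsto A).comp ?_
    simpa using (tendsto_const_nhds (x := A)).add (hlog.const_div_atTop B)
  rw [← hlim.limsup_eq]
  refine Filter.limsup_le_limsup ?_
  filter_upwards [hlog.eventually_gt_atTop 0] with T hT
  rw [EReal.coe_le_coe_iff, div_le_iff₀ hT, add_mul, div_mul_cancel₀ _ hT.ne']
  exact h T

theorem limsup_regret_div_log_le (hε : 0 < ε) (hα : 3 ≤ α) (hsel : IsArgmaxRule sel)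
    (μ : Fin K → unitInterval) :
    Filter.limsup (fun T : ℕ =>
        ((regret (adaPKLUCB K ε α sel T) (fun c => μ c) / Real.log T : ℝ) : EReal)) Filter.atTop ≤
      ((100000 * α * ∑ c with 0 < gap (fun c => (μ c : ℝ)) c, gap (fun c => (μ c : ℝ)) c /
        complexity ε (μ c) (bestMean fun c => (μ c : ℝ)) : ℝ) : EReal) := by
  refine limsup_div_log_le (B := ∑ c with 0 < gap (fun c => (μ c : ℝ)) c, 3) fun T =>
    (regret_adaPKLUCB_le hε hα hsel μ T).trans_eq ?_
  simp only [Finset.sum_add_distrib, mul_div_assoc, Finset.mul_sum, Finset.sum_mul]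

end Main

end PrivateBandit

end

open PrivateBandit in
theorem mainTheorem1_general :
    (∀ (K : ℕ) (ε α : ℝ) (sel : (Fin K → ℝ) → Fin K), 0 < ε → Measurable sel →
      ∀ T : ℕ, IsGlobalDP ε (adaPKLUCB K ε α sel T)) ∧
    ∀ (K : ℕ) (ε α : ℝ) (sel : (Fin K → ℝ) → Fin K) (μ : Fin K → ℝ),
      0 < ε → 3 ≤ α → IsArgmaxRule sel → (∀ a, μ a ∈ Set.Icc (0 : ℝ) 1) →
      (∀ T : ℕ, regret (adaPKLUCB K ε α sel T) μ ≤
        ∑ a with 0 < gap μ a,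
          (100000 * α * gap μ a /
              (min (klBer (μ a) (bestMean μ)) ((6 * ε * gap μ a : ℝ) : EReal)).toReal
            * Real.log T + 3)) ∧
      Filter.limsup
          (fun T : ℕ => ((regret (adaPKLUCB K ε α sel T) μ / Real.log T : ℝ) : EReal))
          Filter.atTop ≤
        ((100000 * α * ∑ a with 0 < gap μ a,
          gap μ a /
            (min (klBer (μ a) (bestMean μ)) ((6 * ε * gap μ a : ℝ) : EReal)).toReal : ℝ) :
          EReal) := by
  refine ⟨fun K ε α sel hε hsel => isGlobalDP_adaPKLUCB hε hsel,
    fun K ε α sel μ hε hα hsel hμ => ?_⟩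
  lift μ to Fin K → unitInterval using hμ
  exact ⟨regret_adaPKLUCB_le hε hα hsel μ, limsup_regret_div_log_le hε hα hsel μ⟩

open PrivateBandit in
/-- The first part is privacy. In the second, `C₂` is an absolute constant and `C₁`, `C₃` depend
on `α` only; its last clause compares the regret with the expression
`∑ Δ_a / min {d(μ_a, μ*), 6 ε Δ_a}` of the problem-dependent lower bound. -/
theorem mainTheorem1 :
    (∀ (K : ℕ) (ε α : ℝ) (sel : (Fin K → ℝ) → Fin K), 0 < ε → 0 < α → IsArgmaxRule sel →
      ∀ T : ℕ, IsGlobalDP ε (adaPKLUCB K ε α sel T)) ∧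
    ∃ C₂ : ℝ, 0 < C₂ ∧ ∀ α : ℝ, 3 < α → ∃ C₁ C₃ : ℝ, 0 < C₁ ∧ 0 < C₃ ∧
      ∀ (K : ℕ) (ε : ℝ) (sel : (Fin K → ℝ) → Fin K) (μ : Fin K → ℝ),
        0 < ε → IsArgmaxRule sel → (∀ a, μ a ∈ Set.Icc (0 : ℝ) 1) →
        (∀ T : ℕ, regret (adaPKLUCB K ε α sel T) μ ≤
          ∑ a with 0 < gap μ a,
            (C₁ * gap μ a /
                (min (klBer (μ a) (bestMean μ)) ((C₂ * ε * gap μ a : ℝ) : EReal)).toReal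
              * Real.log T + 3 * α / (α - 3))) ∧
        Filter.limsup
            (fun T : ℕ => ((regret (adaPKLUCB K ε α sel T) μ / Real.log T : ℝ) : EReal))
            Filter.atTop ≤
          ((C₃ * ∑ a with 0 < gap μ a,
            gap μ a /
              (min (klBer (μ a) (bestMean μ)) ((6 * ε * gap μ a : ℝ) : EReal)).toReal : ℝ) :
            EReal) := by
  obtain ⟨hprivacy, hregret⟩ := mainTheorem1_general
  refine ⟨fun K ε α sel hε _ hsel => hprivacy K ε α sel hε hsel.1, 6, by norm_num, fun α hα =>
    ⟨100000 * α, 100000 * α, by linarith, by linarith, fun K ε sel μ hε hsel hμ =>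
      ⟨fun T => ?_, (hregret K ε α sel μ hε hα.le hsel hμ).2⟩⟩⟩
  refine ((hregret K ε α sel μ hε hα.le hsel hμ).1 T).trans ?_
  gcongr
  rw [le_div_iff₀ (by linarith)]
  linarith
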